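/- Let $m\ge 0$ and $[m]=\{1,\dots,m\}$. A path is a lattice path with $m$ unit steps north or east starting at $(0,0)$; the path $p(I)$ of $I\subseteq[m]$ has $i$-th step north iff $i\in I$, so it ends at $(m-|I|,|I|)$. Let $a\subseteq\{0,1,\dots,m\}$ and let $L$ be the partial staircase with sinks $(m-k,k)$, $k\in a$: its nodes are the points $(x,y)\in\mathbb Z_{\ge 0}^2$ with $x\le m-k$ and $y\le k$ for some $k\in a$, and its edges are the unit segments joining two nodes. Let $V_L$ be the set of all $I\subseteq[m]$ such that $p(I)$ lies in $L$ (equivalently, $|I|\in a$). *Gelfand–Tsetlin patterns.* A cell of $L$ is a unit square of the grid whose northwest or southeast corner is a node of $L$; it is external if not all of its corners are nodes of $L$. A (real-valued) GT pattern of shape $L$ is a filling of the cells of $L$ with non-negative real numbers that weakly increase along rows (west to east) and along columns (north to south), are equal on any two adjacent external cells whose common edge is not an edge of $L$, and vanish on the external cells to the west of $L$. These patterns form the cone $GT_L$. For $I\in V_L$ let $T_{p(I)}\in GT_L$ be the pattern that is $1$ in the cells southeast of $p(I)$ and $0$ in the others. *Compatibility complexes.* A compatibility condition $c$ is a set of unordered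 pairs of subsets of $[m]$ (the compatible pairs). A face of the compatibility complex $\mathbf m^{(c)}_L$ is a subset of $V_L$ whose elements are pairwise compatible. The complex triangulates $GT_L$ if every $T\in GT_L$ has a unique expression $T=\sum_{I\in V_L} w_I T_{p(I)}$ with real $w_I\ge 0$ such that $\{I: w_I\neq 0\}$ is a face; the triangulation is integral if the coefficients $w_I$ are integers whenever all entries of $T$ are integers. *Tableaux and monomials.* Let $X=(x_{ij})$ be the $m\times m$ matrix of indeterminates, rows numbered from the bottom, and let $x_I\in\mathbb C[x_{ij}]$ be the minor with rows $1,\dots,|I|$ and columns $I$ (so $x_\emptyset=1$). Let $A_L\subseteq\mathbb C[x_{ij}]$ be the subalgebra generated by the $x_I$ with $|I|\in a$. An $\mathbf m^{(c)}_L$-tableau is a finite multiset $T$ of elements of $V_L$ whose distinct members form a face; its monomial is $x_T=\prod_{I\in T}x_I$. *Non-crossing.* Pairs $\{u<v\}$ and $\{x<y\}$ in $\mathbb Z\cup\{\infty\}$ are non-crossing if neither $x<u<y<v$ nor $u<x<v<y$. For subsets $I=\{i_1<\dots<i_k\}$ and $J=\{j_1<\dots<j_l\}$ of $[m]$ with $k\le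 l$, delete $i_s$ and $j_s$ for every $s$ with $i_s=j_s$, which leaves $I'=\{i'_1<\dots<i'_{k'}\}$ and $J'=\{j'_1<\dots<j'_{l'}\}$. Then $I,J$ are non-crossing if $\{i'_s,i'_{s+1}\}$ and $\{j'_s,j'_{s+1}\}$ are non-crossing for $1\le s\le k'-1$ and, if $1\le k'<l'$, also $\{i'_{k'},\infty\}$ and $\{j'_{k'},j'_{k'+1}\}$ are non-crossing. Let $\mathbf m^{(nc)}_L$ be the complex of this compatibility condition. **Corollary.** 1. If $c$ is a compatibility condition such that $\mathbf m^{(c)}_L$ triangulates $GT_L$ and the triangulation is integral, then the $\mathbf m^{(c)}_L$-monomials form a $\mathbb C$-linear basis of $A_L$. Moreover, two tableaux have the same monomial if and only if they agree up to the number of empty columns; in particular, if $0\notin a$, the basis is indexed by the $\mathbf m^{(c)}_L$-tableaux. 2. The same conclusions hold, unconditionally, for the non-crossing complex $\mathbf m^{(nc)}_L$: the monomials of non-crossing tableaux form a $\mathbb C$-linear basis of $A_L$, and two such tableaux have the same monomial if and only if they agree up to the number of empty columns. -/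

import Mathlib

namespace PluckerGT

/-! ### Partial staircases, lattice paths and Gelfand-Tsetlin patterns

The ground set `[m] = {1, …, m}` is modelled by `Fin m`; the element `i : Fin m` stands for the
number `i + 1`. Nodes of the square grid are points `(x, y) : ℤ × ℤ` (`x` counts east, `y` counts
north), and a cell is denoted by its southwest corner. -/

/-- The nodes of the partial staircase `L ⊆ L_m` with sinks `(m - k, k)`, `k ∈ a`: all nodes weakly
southwest of one of these sinks, the source being `(0, 0)`. -/
def nodes (m : ℕ) (a : Finset (Fin (m + 1))) : Set (ℤ × ℤ) :=
  {v | ∃ k ∈ a, 0 ≤ v.1 ∧ v.1 ≤ (m : ℤ) - (k : ℕ) ∧ 0 ≤ v.2 ∧ v.2 ≤ ((k : ℕ) : ℤ)}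

/-- The cells of `L`: the northwest or the southeast corner is a node of `L`. -/
def cells (L : Set (ℤ × ℤ)) : Set (ℤ × ℤ) :=
  {z | (z.1, z.2 + 1) ∈ L ∨ (z.1 + 1, z.2) ∈ L}

/-- A cell is internal if its four corners are nodes of `L`, and external otherwise. -/
def IsExternal (L : Set (ℤ × ℤ)) (z : ℤ × ℤ) : Prop :=
  ¬ ((z.1, z.2) ∈ L ∧ (z.1 + 1, z.2) ∈ L ∧ (z.1, z.2 + 1) ∈ L ∧ (z.1 + 1, z.2 + 1) ∈ L)

/-- `z'` is the eastern neighbour of `z`, both are external, and the (vertical) edge that separates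
them is not an edge of `L`. -/
def ConnectedEast (L : Set (ℤ × ℤ)) (z z' : ℤ × ℤ) : Prop :=
  z' = (z.1 + 1, z.2) ∧ IsExternal L z ∧ IsExternal L z' ∧
    ¬ ((z.1 + 1, z.2) ∈ L ∧ (z.1 + 1, z.2 + 1) ∈ L)

/-- `z'` is the northern neighbour of `z`, both are external, and the (horizontal) edge that
separates them is not an edge of `L`. -/
def ConnectedNorth (L : Set (ℤ × ℤ)) (z z' : ℤ × ℤ) : Prop :=
  z' = (z.1, z.2 + 1) ∧ IsExternal L z ∧ IsExternal L z' ∧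
    ¬ ((z.1, z.2 + 1) ∈ L ∧ (z.1 + 1, z.2 + 1) ∈ L)

/-- Real-valued Gelfand-Tsetlin patterns of shape `L`: non-negative fillings of the cells of `L`,
weakly increasing along rows (west to east) and along columns (north to south), equal on connected
external cells, and zero on the external cells to the west of `L`. These form the cone `GT_L`. -/
structure IsGTPattern (L : Set (ℤ × ℤ)) (T : cells L → ℝ) : Prop where
  nonneg : ∀ z, 0 ≤ T z
  row : ∀ z z' : cells L, z.1.2 = z'.1.2 → z.1.1 ≤ z'.1.1 → T z ≤ T z'
  col : ∀ z z' : cells L, z.1.1 = z'.1.1 → z'.1.2 ≤ z.1.2 → T z ≤ T z'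
  connected : ∀ z z' : cells L,
    ConnectedEast L z.1 z'.1 ∨ ConnectedNorth L z.1 z'.1 → T z = T z'
  west : ∀ z : cells L, IsExternal L z.1 → z.1.1 < 0 → T z = 0

/-- The node reached after `t` steps by the path `p(I)`, whose `i`-th step goes north if the `i`-th
element of the ground set lies in `I`, and goes east otherwise. -/
def pathNode {m : ℕ} (I : Finset (Fin m)) (t : ℕ) : ℤ × ℤ :=
  ((t : ℤ) - (I.filter (fun i : Fin m => (i : ℕ) < t)).card, (I.filter (fun i : Fin m => (i : ℕ) < t)).card)

/-- The vertex set of the compatibility complexes `m_L^{(c)}`: the subsets `I` whose path `p(I)`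
fits inside `L`. -/
abbrev Vertex (m : ℕ) (a : Finset (Fin (m + 1))) : Type :=
  {I : Finset (Fin m) // ∀ t ≤ m, pathNode I t ∈ nodes m a}

open Classical in
/-- The pattern `T_p` of the path `p = p(I)`: it is `1` in the cells southeast of `p` (some node
of `p` is weakly northwest of the northwest corner of the cell) and `0` in the other cells. -/
noncomputable def pathPattern {m : ℕ} {a : Finset (Fin (m + 1))} (I : Vertex m a)
    (z : cells (nodes m a)) : ℝ :=
  if ∃ t ≤ m, (pathNode I.1 t).1 ≤ z.1.1 ∧ z.1.2 + 1 ≤ (pathNode I.1 t).2 then 1 else 0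

/-! ### Compatibility complexes and triangulations -/

/-- The faces of `m_L^{(c)}`: sets of vertices that are pairwise compatible with respect to `c`. -/
def IsFace {m : ℕ} {a : Finset (Fin (m + 1))} (c : Finset (Fin m) → Finset (Fin m) → Prop)
    (F : Set (Vertex m a)) : Prop :=
  F.Pairwise (fun I J => c I.1 J.1)

open Classical in
/-- `w` writes `T` as a positive linear combination of the `T_p` with `p` running over a face of
`m_L^{(c)}` (the vertices with a nonzero coefficient). -/
def IsDecomposition {m : ℕ} {a : Finset (Fin (m + 1))}
    (c : Finset (Fin m) → Finset (Fin m) → Prop)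
    (T : cells (nodes m a) → ℝ) (w : Vertex m a → ℝ) : Prop :=
  (∀ I, 0 ≤ w I) ∧ IsFace c {I | w I ≠ 0} ∧ ∀ z, T z = ∑ I, w I * pathPattern I z

/-- `m_L^{(c)}` triangulates the cone `GT_L`: every real-valued pattern has a unique
decomposition. -/
def Triangulates {m : ℕ} (a : Finset (Fin (m + 1)))
    (c : Finset (Fin m) → Finset (Fin m) → Prop) : Prop :=
  ∀ T : cells (nodes m a) → ℝ, IsGTPattern (nodes m a) T → ∃! w, IsDecomposition c T w

/-- The decompositions of the (integer-valued) Gelfand-Tsetlin patterns have integer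
coefficients. -/
def IsIntegral {m : ℕ} (a : Finset (Fin (m + 1)))
    (c : Finset (Fin m) → Finset (Fin m) → Prop) : Prop :=
  ∀ T : cells (nodes m a) → ℝ, IsGTPattern (nodes m a) T → (∀ z, ∃ n : ℕ, T z = n) →
    ∀ w, IsDecomposition c T w → ∀ I, ∃ n : ℕ, w I = n

/-! ### The non-crossing rule -/

/-- The pairs `{u < v}` and `{x < y}` are non-crossing. -/
def NonCrossingPairs {α : Type*} [LT α] (u v x y : α) : Prop :=
  ¬ (x < u ∧ u < y ∧ y < v) ∧ ¬ (u < x ∧ x < v ∧ v < y)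

/-- The positions `s` at which the two increasing lists `I`, `J` have entries `i_s ≠ j_s`, with
these entries. -/
def differing {m : ℕ} (I J : Finset (Fin m)) : List (Fin m × Fin m) :=
  ((I.sort (· ≤ ·)).zip (J.sort (· ≤ ·))).filter (fun q => decide (q.1 ≠ q.2))

/-- The list `I'`: what is left of `I` after the common part with `J` (where `|I| ≤ |J|`) has been
removed. -/
def restSmall {m : ℕ} (I J : Finset (Fin m)) : List (Fin m) :=
  (differing I J).map Prod.fst

/-- The list `J'`: what is left of `J` after the common part with `I` (where `|I| ≤ |J|`) has been
removed. -/
def restLarge {m : ℕ} (I J : Finset (Fin m)) : List (Fin m) :=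
  (differing I J).map Prod.snd ++ (J.sort (· ≤ ·)).drop I.card

/-- The non-crossing rule for `|I| ≤ |J|`; `⊤ : WithTop (Fin m)` is the symbol `∞`. List positions
are counted from `0`. -/
def NonCrossingLE {m : ℕ} (I J : Finset (Fin m)) : Prop :=
  (∀ s (h : s + 1 < (restSmall I J).length) (h' : s + 1 < (restLarge I J).length),
    NonCrossingPairs (restSmall I J)[s] (restSmall I J)[s + 1]
      (restLarge I J)[s] (restLarge I J)[s + 1]) ∧
  (∀ s (h : s + 1 = (restSmall I J).length) (h' : s + 1 < (restLarge I J).length),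
    NonCrossingPairs (((restSmall I J)[s] : Fin m) : WithTop (Fin m)) ⊤
      (((restLarge I J)[s] : Fin m) : WithTop (Fin m))
      (((restLarge I J)[s + 1] : Fin m) : WithTop (Fin m)))

/-- The subsets `I` and `J` are non-crossing. -/
def NonCrossing {m : ℕ} (I J : Finset (Fin m)) : Prop :=
  if I.card ≤ J.card then NonCrossingLE I J else NonCrossingLE J I

/-! ### Plücker coordinates, tableaux and their monomials -/

/-- The Plücker coordinate `x_I`: the minor of the generic `m × m` matrix with row set
`1, …, |I|` (rows are numbered from the bottom) and column set `I`. -/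
noncomputable def plucker {m : ℕ} (I : Finset (Fin m)) : MvPolynomial (Fin m × Fin m) ℂ :=
  ((Matrix.mvPolynomialX (Fin m) (Fin m) ℂ).submatrix
    (Fin.castLE (by simpa using I.card_le_univ : I.card ≤ m)) (I.orderEmbOfFin rfl)).det

/-- The subalgebra of the Plücker algebra generated by the minors of sizes `k ∈ a`. -/
noncomputable def pluckerAlgebra (m : ℕ) (a : Finset (Fin (m + 1))) :
    Subalgebra ℂ (MvPolynomial (Fin m × Fin m) ℂ) :=
  Algebra.adjoin ℂ {f | ∃ I : Finset (Fin m), (∃ k ∈ a, I.card = (k : ℕ)) ∧ f = plucker I}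

/-- An `m_L^{(c)}`-tableau: a finite collection (with repetitions) of vertices, the columns, whose
distinct members form a face. -/
abbrev Tableau {m : ℕ} (a : Finset (Fin (m + 1)))
    (c : Finset (Fin m) → Finset (Fin m) → Prop) : Type :=
  {T : Multiset (Vertex m a) // IsFace c {I | I ∈ T}}

/-- The `m_L^{(c)}`-monomial `x_T`, the product of `x_I` over the columns `I` of `T`. -/
noncomputable def Tableau.monomial {m : ℕ} {a : Finset (Fin (m + 1))}
    {c : Finset (Fin m) → Finset (Fin m) → Prop} (T : Tableau a c) :
    MvPolynomial (Fin m × Fin m) ℂ :=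
  (T.1.map (fun I => plucker I.1)).prod

/-- The `m_L^{(c)}`-monomials form a linear basis of the subalgebra generated by the minors of
sizes `k ∈ a`, and are indexed by the tableaux: distinct tableaux have distinct monomials, except
that empty columns do not count, since `x_∅ = 1` (they occur only if `0 ∈ a`). -/
structure MonomialsFormBasis {m : ℕ} (a : Finset (Fin (m + 1)))
    (c : Finset (Fin m) → Finset (Fin m) → Prop) : Prop where
  linearIndependent :
    LinearIndepOn ℂ id (Set.range (Tableau.monomial : Tableau a c → _))
  span_eq : Submodule.span ℂ (Set.range (Tableau.monomial : Tableau a c → _)) =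
    Subalgebra.toSubmodule (pluckerAlgebra m a)
  monomial_eq_iff : ∀ T T' : Tableau a c, T.monomial = T'.monomial ↔
    ∀ I : Vertex m a, I.1.Nonempty → T.1.count I = T'.1.count I

end PluckerGT

/-!
The statement reduces to `HasUniqueTableaux`: for every multiset of columns there is exactly one
tableau with the same *heights*, i.e. whose paths pass through the same multiset of nodes on every
antidiagonal `x + y = t`.

**From unique tableaux to the basis.** If `x_{s,v}` has weight `s * v`, then by the rearrangement
inequality the diagonal term of a minor is its unique term of largest weight (`isLead_plucker`).
Hence the leading exponent of a product of minors is the sum of the diagonal exponents, which knows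
the heights of the nonempty columns (`sameHeights_of_diagExponent`). So tableaux that differ in
more than empty columns have different leading exponents, which gives linear independence and the
rule for the equality of monomials. For the spanning property, Garnir's exchange relation
(`plucker_mul_mem_span`) rewrites every product of minors as a combination of standard products
with the same column lengths. A standard multiset of columns is determined by its heights. Sending
it to the tableau with these heights is therefore injective, and a comparison of dimensions
shows that the monomials of these tableaux span the same space as the standard products
(`HasUniqueTableaux.prod_mem_span`).

**Triangulations.** The entry of the pattern `T_p(I)` in the cell `(x, y)` is `1` if and only if the
height of `p(I)` at time `x + y + 1` exceeds `y`. Thus the pattern of a multiset of columns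
determines its heights and conversely, and the decomposition of this pattern in an integral
triangulation is a tableau (`hasUniqueTableaux_of_triangulates`).

**The non-crossing complex.** In terms of paths, two sets are non-crossing if and only if the upper
one of two paths that meet is never again the upper one when they separate (`nonCrossing_iff`).
Such multisets of columns exist with any given heights, since switching the ends of two paths that
violate the condition at time `t` decreases a suitable sum (`exists_avoidsUntil`). They are unique,
since among the paths that meet in a node those that go north have to be the ones that were below
the others when they last differed (`eq_of_avoidsUntil`).
-/

namespace PluckerGT

/-! ### Heights of lattice paths -/

/-- The number of north steps of `p(I)` among its first `t` steps. -/
def height {m : ℕ} (I : Finset (Fin m)) (t : ℕ) : ℕ :=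
  (I.filter (fun i : Fin m => (i : ℕ) < t)).card

theorem height_le_card {m : ℕ} (I : Finset (Fin m)) (t : ℕ) : height I t ≤ I.card :=
  Finset.card_filter_le _ _

theorem height_mono {m : ℕ} (I : Finset (Fin m)) : Monotone (height I) := by
  intro s t hst
  refine Finset.card_le_card fun i hi => ?_
  simp only [Finset.mem_filter] at hi ⊢
  exact ⟨hi.1, hi.2.trans_le hst⟩

theorem height_zero {m : ℕ} (I : Finset (Fin m)) : height I 0 = 0 := by
  simp [height]

theorem height_of_le {m : ℕ} (I : Finset (Fin m)) {t : ℕ} (ht : m ≤ t) : height I t = I.card := by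
  rw [height, Finset.filter_true_of_mem]
  exact fun i _ => i.2.trans_le ht

theorem height_succ {m : ℕ} (I : Finset (Fin m)) (v : Fin m) :
    height I (v + 1) = height I v + if v ∈ I then 1 else 0 := by
  have : I.filter (fun i : Fin m => (i : ℕ) < v + 1) =
      I.filter (fun i : Fin m => (i : ℕ) < v) ∪ I.filter (fun i : Fin m => i = v) := by
    ext i
    simp only [Finset.mem_filter, Finset.mem_union, Fin.ext_iff, Nat.lt_succ_iff_lt_or_eq]
    tauto
  rw [height, this, Finset.card_union_of_disjoint, height, Finset.filter_eq']
  · split_ifs <;> simp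
  · rw [Finset.disjoint_filter]
    rintro i _ h rfl
    exact lt_irrefl _ h

theorem height_succ_le {m : ℕ} (I : Finset (Fin m)) (t : ℕ) :
    height I (t + 1) ≤ height I t + 1 := by
  by_cases ht : t < m
  · have := height_succ I ⟨t, ht⟩
    simp only at this
    rw [this]; split_ifs <;> omega
  · rw [height_of_le I (by omega), height_of_le I (by omega)]; omega

theorem height_add_le {m : ℕ} (I : Finset (Fin m)) (t d : ℕ) :
    height I (t + d) ≤ height I t + d := by
  induction d with
  | zero => simp
  | succ d ih => have := height_succ_le I (t + d); rw [← add_assoc]; omega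

theorem height_le {m : ℕ} (I : Finset (Fin m)) (t : ℕ) : height I t ≤ t := by
  induction t with
  | zero => simp [height_zero]
  | succ t ih => have := height_succ_le I t; omega

theorem height_le' {m : ℕ} (I : Finset (Fin m)) (t : ℕ) : height I t ≤ m :=
  (height_le_card I t).trans (by simpa using I.card_le_univ)

theorem mem_iff_height {m : ℕ} (I : Finset (Fin m)) (v : Fin m) :
    v ∈ I ↔ height I v < height I (v + 1) := by
  rw [height_succ]; split_ifs <;> simp_all

theorem eq_of_height_eq {m : ℕ} {I J : Finset (Fin m)} (h : ∀ t ≤ m, height I t = height J t) :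
    I = J := by
  ext v
  rw [mem_iff_height, mem_iff_height, h _ v.2.le, h _ v.2]

/-- Two multisets of columns have the same heights if their paths cross every antidiagonal in the
same multisets of nodes. This means that their Gelfand-Tsetlin patterns agree. -/
def SameHeights {m : ℕ} (S T : Multiset (Finset (Fin m))) : Prop :=
  ∀ t, S.map (fun I => height I t) = T.map (fun I => height I t)

theorem SameHeights.map_card {m : ℕ} {S T : Multiset (Finset (Fin m))} (h : SameHeights S T) :
    S.map Finset.card = T.map Finset.card := by
  simpa only [height_of_le _ le_rfl] using h m

theorem SameHeights.symm {m : ℕ} {S T : Multiset (Finset (Fin m))} (h : SameHeights S T) :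
    SameHeights T S := fun t => (h t).symm

theorem SameHeights.trans {m : ℕ} {S T U : Multiset (Finset (Fin m))} (h : SameHeights S T)
    (h' : SameHeights T U) : SameHeights S U := fun t => (h t).trans (h' t)

/-! ### Minors as alternating maps and the exchange relation -/

/-- The minor on the first `k` rows of the generic matrix whose columns are given by an arbitrary
function `c` on an index type with `k` elements. -/
noncomputable def minorOn {m k : ℕ} {κ : Type*} [Fintype κ] [DecidableEq κ] (hk : k ≤ m)
    (e : κ ≃ Fin k) (c : κ → Fin m) : MvPolynomial (Fin m × Fin m) ℂ :=
  (Matrix.of fun j i : κ => MvPolynomial.X (Fin.castLE hk (e i), c j)).det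

theorem minorOn_eq_zero {m k : ℕ} {κ : Type*} [Fintype κ] [DecidableEq κ] (hk : k ≤ m)
    (e : κ ≃ Fin k) (c : κ → Fin m) (hc : ¬ Function.Injective c) : minorOn hk e c = 0 := by
  simp only [Function.Injective, not_forall] at hc
  obtain ⟨x, y, hxy, hne⟩ := hc
  refine Matrix.det_zero_of_row_eq hne ?_
  ext i
  simp [hxy]

theorem minorOn_eq_sign_smul {m k : ℕ} {κ : Type*} [Fintype κ] [DecidableEq κ] (hk : k ≤ m)
    (e : κ ≃ Fin k) (c : κ → Fin m) (hc : Function.Injective c) :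
    ∃ ε : ℤˣ, minorOn hk e c = ε • plucker (Finset.univ.image c) := by
  classical
  have hcard : k = (Finset.univ.image c).card := by
    rw [Finset.card_image_of_injective _ hc, Finset.card_univ, Fintype.card_congr e,
      Fintype.card_fin]
  generalize hI : Finset.univ.image c = I at hcard
  subst hcard
  let g₀ : κ ≃ I := (Equiv.ofInjective c hc).trans
    (Equiv.setCongr (by rw [← hI]; simp))
  let g : κ ≃ Fin I.card := g₀.trans (I.orderIsoOfFin rfl).symm.toEquiv
  have hg : ∀ j, I.orderEmbOfFin rfl (g j) = c j := by
    intro j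
    have : I.orderIsoOfFin rfl (g j) = g₀ j := by simp [g]
    rw [← Finset.coe_orderIsoOfFin_apply, this]
    rfl
  let P := (Matrix.mvPolynomialX (Fin m) (Fin m) ℂ).submatrix
    (Fin.castLE hk) (I.orderEmbOfFin rfl)
  have h1 : minorOn hk e c = ((P.submatrix (g.symm.trans e) id).submatrix g g).det := by
    rw [minorOn, ← Matrix.det_transpose]
    congr 1
    ext i j
    simp [P, hg]
  refine ⟨Equiv.Perm.sign (g.symm.trans e), ?_⟩
  rw [h1, Matrix.det_submatrix_equiv_self, Matrix.det_permute]
  simp only [P, plucker, Units.smul_def, zsmul_eq_mul]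

/-- Freezing the arguments of an alternating map in the left summand of its index type. -/
def fixLeft {R M N φ ι : Type*} [CommRing R] [AddCommGroup M] [Module R M] [AddCommGroup N]
    [Module R N] (A : M [⋀^φ ⊕ ι]→ₗ[R] N) (f : φ → M) : M [⋀^ι]→ₗ[R] N where
  toFun v := A (Sum.elim f v)
  map_update_add' v i x y := by
    classical
    have : ∀ z, Sum.elim f (Function.update v i z) =
        Function.update (Sum.elim f v) (Sum.inr i) z := fun z => by
      convert (Sum.elim_update_right f v i z)
    rw [this, this, this, A.map_update_add]
  map_update_smul' v i r x := by
    classical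
    have : ∀ z, Sum.elim f (Function.update v i z) =
        Function.update (Sum.elim f v) (Sum.inr i) z := fun z => by
      convert (Sum.elim_update_right f v i z)
    rw [this, this, A.map_update_smul]
  map_eq_zero_of_eq' v i j h hij :=
    A.map_eq_zero_of_eq (Sum.elim f v) (i := Sum.inr i) (j := Sum.inr j) (by simpa using h)
      (by simpa using hij)

/-- The minor `minorOn` as an alternating function of the columns indexed by `ι`, the columns
indexed by `φ` being those of `f`. A column is a vector of length `n ≥ k`, of which only the first
`k` entries matter. -/
noncomputable def minorAlternating {m n k : ℕ} (hkn : k ≤ n) (hn : n ≤ m) {φ ι : Type*}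
    [Fintype φ] [Fintype ι] [DecidableEq φ] [DecidableEq ι] (e : φ ⊕ ι ≃ Fin k) (f : φ → Fin m) :
    (Fin n → MvPolynomial (Fin m × Fin m) ℂ) [⋀^ι]→ₗ[MvPolynomial (Fin m × Fin m) ℂ]
      MvPolynomial (Fin m × Fin m) ℂ :=
  fixLeft ((Matrix.detRowAlternating (n := φ ⊕ ι)).compLinearMap
    (LinearMap.funLeft _ _ (fun i => Fin.castLE hkn (e i))))
    (fun j r => MvPolynomial.X (Fin.castLE hn r, f j))

theorem minorAlternating_apply {m n k : ℕ} (hkn : k ≤ n) (hn : n ≤ m) {φ ι : Type*}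
    [Fintype φ] [Fintype ι] [DecidableEq φ] [DecidableEq ι] (e : φ ⊕ ι ≃ Fin k) (f : φ → Fin m)
    (c : ι → Fin m) :
    minorAlternating hkn hn e f (fun j r => MvPolynomial.X (Fin.castLE hn r, c j)) =
      minorOn (hkn.trans hn) e (Sum.elim f c) := by
  simp only [minorAlternating, fixLeft, minorOn, AlternatingMap.coe_mk, MultilinearMap.coe_mk,
    AlternatingMap.compLinearMap_apply, Matrix.detRowAlternating]
  change Matrix.det _ = Matrix.det _
  congr 1
  ext1 j i
  rcases j with j | j <;> simp [LinearMap.funLeft]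

/-- An alternating map of more than `n` vectors of length `n` over a domain vanishes. -/
theorem alternating_eq_zero {R N ι : Type*} [CommRing R] [IsDomain R] [AddCommGroup N] [Module R N]
    [Module.IsTorsionFree R N] [Fintype ι] {n : ℕ} (A : (Fin n → R) [⋀^ι]→ₗ[R] N)
    (h : n < Fintype.card ι) (v : ι → Fin n → R) : A v = 0 := by
  refine A.map_linearDependent v fun hv => ?_
  have := hv.fintype_card_le_finrank
  simp at this
  omega

theorem sum_image_univ {m : ℕ} {κ : Type*} [Fintype κ] (c : κ → Fin m)
    (hc : Function.Injective c) :
    ∑ i ∈ Finset.univ.image c, (i : ℕ) = ∑ j, (c j : ℕ) :=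
  Finset.sum_image fun _ _ _ _ h => hc h

theorem units_smul_mem_iff {M : Type*} [AddCommGroup M] [Module ℂ M] (W : Submodule ℂ M)
    (ε : ℤˣ) (x : M) : ε • x ∈ W ↔ x ∈ W := by
  rcases Int.units_eq_one_or ε with rfl | rfl
  · simp
  · simp [Units.smul_def]

/-- If all weights in the left block are below `t` and those in the right block are not, then a
permutation that moves something from the left to the right block decreases the sum of the weights
in the right block. -/
theorem sum_comp_inr_lt {α β : Type*} [Fintype α] [Fintype β] (w : α ⊕ β → ℕ) (t : ℕ)
    (h1 : ∀ x, w (Sum.inl x) < t) (h2 : ∀ x, t ≤ w (Sum.inr x)) (σ : Equiv.Perm (α ⊕ β))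
    (hσ : ∃ y x, σ (Sum.inr y) = Sum.inl x) :
    ∑ y, w (σ (Sum.inr y)) < ∑ y, w (Sum.inr y) := by
  classical
  have key : ∑ y, ((w (σ (Sum.inr y)) : ℤ) - t) < ∑ y, ((w (Sum.inr y) : ℤ) - t) := by
    let g : α ⊕ β → ℤ := fun x => (w x : ℤ) - t
    have e1 : ∑ y, ((w (σ (Sum.inr y)) : ℤ) - t) =
        ∑ x, if (σ.symm x).isRight then g x else 0 := by
      rw [← Equiv.sum_comp σ]
      simp [Fintype.sum_sum_type, g]
    have e2 : ∑ y, ((w (Sum.inr y) : ℤ) - t) = ∑ x, if x.isRight then g x else 0 := by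
      simp [Fintype.sum_sum_type, g]
    rw [e1, e2]
    refine Finset.sum_lt_sum ?_ ?_
    · rintro (x | x) -
      · have := h1 x
        simp only [Sum.isRight_inl, g]
        split_ifs <;> first | omega | simp_all
      · have := h2 x
        simp only [Sum.isRight_inr, g]
        split_ifs <;> first | omega | simp_all
    · obtain ⟨y, x, hyx⟩ := hσ
      refine ⟨Sum.inl x, Finset.mem_univ _, ?_⟩
      have := h1 x
      simp only [← hyx, Equiv.symm_apply_apply, Sum.isRight_inr, g]
      simp only [hyx]
      simp
      omega
  simp only [Finset.sum_sub_distrib] at key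
  have h3 := sub_lt_sub_iff_right _ |>.mp key
  exact_mod_cast h3

open scoped TensorProduct in
/-- Garnir's exchange relation: if `|J| ≤ |I|`, but `p(J)` runs somewhere above `p(I)`, then
`x_I x_J` is a combination of products in which `I` has been replaced by a smaller set. -/
theorem plucker_mul_mem_span {m : ℕ} (I J : Finset (Fin m)) (hJI : J.card ≤ I.card) (t : ℕ)
    (ht : height I t < height J t) :
    plucker I * plucker J ∈ Submodule.span ℂ
      {f | ∃ I' J' : Finset (Fin m), I'.card = I.card ∧ J'.card = J.card ∧
        ∑ i ∈ I', (i : ℕ) < ∑ i ∈ I, (i : ℕ) ∧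
        ∑ i ∈ I', (i : ℕ) + ∑ i ∈ J', (i : ℕ) = ∑ i ∈ I, (i : ℕ) + ∑ i ∈ J, (i : ℕ) ∧
        f = plucker I' * plucker J'} := by
  classical
  set W := Submodule.span ℂ
      {f | ∃ I' J' : Finset (Fin m), I'.card = I.card ∧ J'.card = J.card ∧
        ∑ i ∈ I', (i : ℕ) < ∑ i ∈ I, (i : ℕ) ∧
        ∑ i ∈ I', (i : ℕ) + ∑ i ∈ J', (i : ℕ) = ∑ i ∈ I, (i : ℕ) + ∑ i ∈ J, (i : ℕ) ∧
        f = plucker I' * plucker J'} with hW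
  let I₁ := {i : Fin m // i ∈ I.filter (fun i : Fin m => (i : ℕ) < t)}
  let I₂ := {i : Fin m // i ∈ I.filter (fun i : Fin m => ¬ (i : ℕ) < t)}
  let J₁ := {i : Fin m // i ∈ J.filter (fun i : Fin m => (i : ℕ) < t)}
  let J₂ := {i : Fin m // i ∈ J.filter (fun i : Fin m => ¬ (i : ℕ) < t)}
  have cI := Finset.card_filter_add_card_filter_not (s := I) (fun i => (i : ℕ) < t)
  have cJ := Finset.card_filter_add_card_filter_not (s := J) (fun i => (i : ℕ) < t)
  have sI := Finset.sum_filter_add_sum_filter_not I (fun i => (i : ℕ) < t) (fun i => (i : ℕ))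
  have sJ := Finset.sum_filter_add_sum_filter_not J (fun i => (i : ℕ) < t) (fun i => (i : ℕ))
  have sI₁ : ∑ i : I₁, (i.1 : ℕ) = ∑ i ∈ I.filter (fun i : Fin m => (i : ℕ) < t), (i : ℕ) :=
    Finset.sum_coe_sort (I.filter (fun i : Fin m => (i : ℕ) < t)) (fun i => (i : ℕ))
  have sI₂ : ∑ i : I₂, (i.1 : ℕ) = ∑ i ∈ I.filter (fun i : Fin m => ¬ (i : ℕ) < t), (i : ℕ) :=
    Finset.sum_coe_sort (I.filter (fun i : Fin m => ¬ (i : ℕ) < t)) (fun i => (i : ℕ))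
  have sJ₁ : ∑ i : J₁, (i.1 : ℕ) = ∑ i ∈ J.filter (fun i : Fin m => (i : ℕ) < t), (i : ℕ) :=
    Finset.sum_coe_sort (J.filter (fun i : Fin m => (i : ℕ) < t)) (fun i => (i : ℕ))
  have sJ₂ : ∑ i : J₂, (i.1 : ℕ) = ∑ i ∈ J.filter (fun i : Fin m => ¬ (i : ℕ) < t), (i : ℕ) :=
    Finset.sum_coe_sort (J.filter (fun i : Fin m => ¬ (i : ℕ) < t)) (fun i => (i : ℕ))
  have kI : Fintype.card (I₁ ⊕ I₂) = I.card := by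
    rw [Fintype.card_sum, Fintype.card_coe, Fintype.card_coe]; exact cI
  have kJ : Fintype.card (J₂ ⊕ J₁) = J.card := by
    rw [Fintype.card_sum, Fintype.card_coe, Fintype.card_coe, add_comm]; exact cJ
  let eI : I₁ ⊕ I₂ ≃ Fin I.card := Fintype.equivFinOfCardEq kI
  let eJ : J₂ ⊕ J₁ ≃ Fin J.card := Fintype.equivFinOfCardEq kJ
  have hn : I.card ≤ m := by simpa using I.card_le_univ
  let A := minorAlternating hJI hn eJ (fun j => j.1)
  let B := minorAlternating le_rfl hn eI (fun j => j.1)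
  let w : J₁ ⊕ I₂ → Fin m := Sum.elim (fun j => j.1) (fun j => j.1)
  let v : J₁ ⊕ I₂ → Fin I.card → MvPolynomial (Fin m × Fin m) ℂ :=
    fun j r => MvPolynomial.X (Fin.castLE hn r, w j)
  have hcard : I.card < Fintype.card (J₁ ⊕ I₂) := by
    rw [Fintype.card_sum, Fintype.card_coe, Fintype.card_coe]
    simp only [height] at ht
    omega
  -- the columns in `J₁` and `I₂` are too many for the signed sum over their shuffles not to vanish
  have h0 := alternating_eq_zero
    ((LinearMap.mul' (MvPolynomial (Fin m × Fin m) ℂ) _).compAlternatingMap (A.domCoprod B))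
    hcard v
  rw [LinearMap.compAlternatingMap_apply, AlternatingMap.domCoprod_apply, _root_.sum_apply,
    map_sum] at h0
  replace h0 := (Finset.add_sum_erase _ _
    (@Finset.mem_univ _ _ (Quotient.mk'' 1 : Equiv.Perm.ModSumCongr J₁ I₂))).trans h0
  have term : ∀ σ : Equiv.Perm (J₁ ⊕ I₂),
      LinearMap.mul' (MvPolynomial (Fin m × Fin m) ℂ) _
        (AlternatingMap.domCoprod.summand A B (Quotient.mk'' σ) v) =
      Equiv.Perm.sign σ •
        (minorOn (hJI.trans hn) eJ (Sum.elim (fun j => j.1) (fun j => w (σ (Sum.inl j)))) *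
          minorOn hn eI (Sum.elim (fun j => j.1) (fun j => w (σ (Sum.inr j))))) := by
    intro σ
    rw [← minorAlternating_apply hJI hn, ← minorAlternating_apply le_rfl hn]
    change LinearMap.mul' (MvPolynomial (Fin m × Fin m) ℂ) _ (Equiv.Perm.sign σ •
      ((A fun j => v (σ (Sum.inl j))) ⊗ₜ[MvPolynomial (Fin m × Fin m) ℂ]
        (B fun j => v (σ (Sum.inr j))))) = _
    rw [Units.smul_def, map_zsmul, LinearMap.mul'_apply, Units.smul_def]
  -- the trivial shuffle contributes `x_I x_J`, up to a sign
  have main : plucker I * plucker J ∈ W ↔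
      LinearMap.mul' (MvPolynomial (Fin m × Fin m) ℂ) _
        (AlternatingMap.domCoprod.summand A B (Quotient.mk'' 1) v) ∈ W := by
    rw [term]
    have i1 : Function.Injective
        (Sum.elim (fun j : J₂ => j.1)
          (fun j : J₁ => w ((1 : Equiv.Perm (J₁ ⊕ I₂)) (Sum.inl j)))) := by
      rintro (⟨x, hx⟩ | ⟨x, hx⟩) (⟨y, hy⟩ | ⟨y, hy⟩) h <;>
        (simp [w] at h; subst h; first | rfl | (simp only [Finset.mem_filter] at hx hy; tauto))
    have i2 : Function.Injective
        (Sum.elim (fun j : I₁ => j.1)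
          (fun j : I₂ => w ((1 : Equiv.Perm (J₁ ⊕ I₂)) (Sum.inr j)))) := by
      rintro (⟨x, hx⟩ | ⟨x, hx⟩) (⟨y, hy⟩ | ⟨y, hy⟩) h <;>
        (simp [w] at h; subst h; first | rfl | (simp only [Finset.mem_filter] at hx hy; tauto))
    obtain ⟨ε, h1⟩ := minorOn_eq_sign_smul (hJI.trans hn) eJ _ i1
    obtain ⟨δ, h2⟩ := minorOn_eq_sign_smul hn eI _ i2
    have j1 : Finset.univ.image (Sum.elim (fun j : J₂ => j.1)
        (fun j : J₁ => w ((1 : Equiv.Perm (J₁ ⊕ I₂)) (Sum.inl j)))) = J := by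
      ext x
      by_cases hx : (x : ℕ) < t <;> simp [w, J₁, J₂, hx] <;> omega
    have j2 : Finset.univ.image (Sum.elim (fun j : I₁ => j.1)
        (fun j : I₂ => w ((1 : Equiv.Perm (J₁ ⊕ I₂)) (Sum.inr j)))) = I := by
      ext x
      by_cases hx : (x : ℕ) < t <;> simp [w, I₁, I₂, hx] <;> omega
    rw [h1, h2, j1, j2, smul_mul_smul_comm, smul_smul, units_smul_mem_iff, mul_comm]
  rw [main, eq_neg_of_add_eq_zero_left h0]
  -- every other shuffle moves an element of `J₁` into `I`
  refine W.neg_mem (W.sum_mem fun τ hτ => ?_)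
  induction τ using Quotient.inductionOn' with | _ σ
  rw [term, units_smul_mem_iff]
  set cJ' := Sum.elim (fun j : J₂ => j.1) (fun j : J₁ => w (σ (Sum.inl j))) with hcJ'
  set cI' := Sum.elim (fun j : I₁ => j.1) (fun j : I₂ => w (σ (Sum.inr j))) with hcI'
  by_cases i1 : Function.Injective cJ'
  swap
  · rw [minorOn_eq_zero _ _ _ i1, zero_mul]; exact W.zero_mem
  by_cases i2 : Function.Injective cI'
  swap
  · rw [minorOn_eq_zero _ _ _ i2, mul_zero]; exact W.zero_mem
  obtain ⟨ε, h1⟩ := minorOn_eq_sign_smul (hJI.trans hn) eJ _ i1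
  obtain ⟨δ, h2⟩ := minorOn_eq_sign_smul hn eI _ i2
  rw [h1, h2, smul_mul_smul_comm, units_smul_mem_iff]
  refine Submodule.subset_span ⟨_, _, ?_, ?_, ?_, ?_, mul_comm _ _⟩
  · rw [Finset.card_image_of_injective _ i2, Finset.card_univ, kI]
  · rw [Finset.card_image_of_injective _ i1, Finset.card_univ, kJ]
  · rw [sum_image_univ _ i2, Fintype.sum_sum_type, ← sI]
    simp only [hcI', Sum.elim_inl, Sum.elim_inr]
    rw [sI₁, ← sI₂]
    refine Nat.add_lt_add_left (sum_comp_inr_lt (fun x => (w x : ℕ)) t ?_ ?_ σ ?_) _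
    · rintro ⟨x, hx⟩; exact (Finset.mem_filter.mp hx).2
    · rintro ⟨x, hx⟩; exact not_lt.mp (Finset.mem_filter.mp hx).2
    · by_contra hne
      push Not at hne
      refine (Finset.mem_erase.mp hτ).1 (Quotient.sound' ?_)
      rw [QuotientGroup.leftRel_apply, mul_one]
      refine inv_mem (Equiv.Perm.mem_sumCongrHom_range_of_perm_mapsTo_inl ?_)
      rw [Equiv.Perm.perm_mapsTo_inl_iff_mapsTo_inr]
      rintro _ ⟨y, rfl⟩
      rcases hy : σ (Sum.inr y) with x | x
      · exact absurd hy (hne y x)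
      · exact ⟨x, rfl⟩
  · rw [sum_image_univ _ i2, sum_image_univ _ i1, Fintype.sum_sum_type, Fintype.sum_sum_type]
    simp only [hcI', hcJ', Sum.elim_inl, Sum.elim_inr]
    have := Equiv.sum_comp σ (fun x => (w x : ℕ))
    rw [Fintype.sum_sum_type, Fintype.sum_sum_type] at this
    have e1 : ∑ x : J₁, ((w (Sum.inl x) : Fin m) : ℕ) = ∑ i : J₁, (i.1 : ℕ) := rfl
    have e2 : ∑ x : I₂, ((w (Sum.inr x) : Fin m) : ℕ) = ∑ i : I₂, (i.1 : ℕ) := rfl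
    omega

/-! ### Standard products and the straightening law -/

/-- A multiset of columns is standard if it can be arranged so that the path of every column runs
weakly below those of its predecessors: the columns of a semistandard tableau. -/
def IsStandard {m : ℕ} (S : Multiset (Finset (Fin m))) : Prop :=
  ∃ l : List (Finset (Fin m)), (l : Multiset (Finset (Fin m))) = S ∧
    l.Pairwise (fun I J => ∀ t, height J t ≤ height I t)

theorem prod_eq_mul_mul_prod_erase {ι M : Type*} [Fintype ι] [DecidableEq ι] [CommMonoid M]
    {p q : ι} (hpq : p ≠ q) (g : ι → M) :
    ∏ x, g x = g p * g q * ∏ x ∈ (Finset.univ.erase p).erase q, g x := by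
  rw [mul_assoc, Finset.mul_prod_erase (Finset.univ.erase p) g (by simpa using hpq.symm),
    Finset.mul_prod_erase _ _ (Finset.mem_univ p)]

theorem sum_eq_add_add_sum_erase {ι M : Type*} [Fintype ι] [DecidableEq ι] [AddCommMonoid M]
    {p q : ι} (hpq : p ≠ q) (g : ι → M) :
    ∑ x, g x = g p + g q + ∑ x ∈ (Finset.univ.erase p).erase q, g x := by
  rw [add_assoc, Finset.add_sum_erase (Finset.univ.erase p) g (by simpa using hpq.symm),
    Finset.add_sum_erase _ _ (Finset.mem_univ p)]

/-- Straightening of a product whose factors are ordered by size. The induction is on the sum of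
the entries, the columns being weighted from right to left, which the exchange relation lowers. -/
theorem prod_plucker_mem_span {m n : ℕ} (N : ℕ) :
    ∀ L : Fin n → Finset (Fin m), (∀ p q, p ≤ q → (L q).card ≤ (L p).card) →
      ∑ x, (n - x) * ∑ i ∈ L x, (i : ℕ) < N →
      ∏ x, plucker (L x) ∈ Submodule.span ℂ
        {f | ∃ S : Fin n → Finset (Fin m), (∀ p, (S p).card = (L p).card) ∧
          (∀ p q, p < q → ∀ t, height (S q) t ≤ height (S p) t) ∧ f = ∏ x, plucker (S x)} := by
  induction N with
  | zero => intro L _ h; omega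
  | succ N ih =>
    intro L hL hN
    set W := Submodule.span ℂ
        {f | ∃ S : Fin n → Finset (Fin m), (∀ p, (S p).card = (L p).card) ∧
          (∀ p q, p < q → ∀ t, height (S q) t ≤ height (S p) t) ∧ f = ∏ x, plucker (S x)} with hW
    by_cases hs : ∀ p q, p < q → ∀ t, height (L q) t ≤ height (L p) t
    · exact Submodule.subset_span ⟨L, fun _ => rfl, hs, rfl⟩
    push Not at hs
    obtain ⟨p, q, hpq, t, ht⟩ := hs
    rw [prod_eq_mul_mul_prod_erase hpq.ne]
    set R := ∏ x ∈ (Finset.univ.erase p).erase q, plucker (L x) with hR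
    have hle : Submodule.span ℂ
        {f | ∃ I' J' : Finset (Fin m), I'.card = (L p).card ∧ J'.card = (L q).card ∧
          ∑ i ∈ I', (i : ℕ) < ∑ i ∈ L p, (i : ℕ) ∧
          ∑ i ∈ I', (i : ℕ) + ∑ i ∈ J', (i : ℕ) = ∑ i ∈ L p, (i : ℕ) + ∑ i ∈ L q, (i : ℕ) ∧
          f = plucker I' * plucker J'} ≤ W.comap (LinearMap.mulRight ℂ R) := by
      rw [Submodule.span_le]
      rintro _ ⟨I', J', hI', hJ', hlt, hadd, rfl⟩
      let L' := Function.update (Function.update L p I') q J'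
      have hp : L' p = I' := by simp [L', hpq.ne]
      have hq : L' q = J' := by simp [L']
      have ho : ∀ x ∈ (Finset.univ.erase p).erase q, L' x = L x := by
        intro x hx
        simp only [Finset.mem_erase, Finset.mem_univ, and_true] at hx
        simp [L', hx.1, hx.2]
      have hc : ∀ x, (L' x).card = (L x).card := by
        intro x
        by_cases h1 : x = q
        · subst h1; rw [hq, hJ']
        by_cases h2 : x = p
        · subst h2; rw [hp, hI']
        rw [ho x (by simp [h1, h2])]
      have hlow : ∑ x, (n - x) * ∑ i ∈ L' x, (i : ℕ) < N := by
        refine lt_of_lt_of_le ?_ (Nat.lt_succ_iff.mp hN)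
        have hrest : ∑ x ∈ (Finset.univ.erase p).erase q, (n - (x : ℕ)) * ∑ i ∈ L' x, (i : ℕ) =
            ∑ x ∈ (Finset.univ.erase p).erase q, (n - (x : ℕ)) * ∑ i ∈ L x, (i : ℕ) :=
          Finset.sum_congr rfl fun x hx => by rw [ho x hx]
        rw [sum_eq_add_add_sum_erase hpq.ne, sum_eq_add_add_sum_erase hpq.ne, hp, hq, hrest]
        refine Nat.add_lt_add_right ?_ _
        have hpq' : n - (q : ℕ) < n - (p : ℕ) := by have := q.2; have := Fin.lt_def.mp hpq; omega
        -- the weight of column `p` exceeds that of column `q`, and `p` passes entries to `q`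
        generalize n - (q : ℕ) = B at *
        generalize n - (p : ℕ) = A at *
        obtain ⟨c, rfl⟩ := Nat.exists_eq_add_of_lt hpq'
        nlinarith
      have := ih L' (fun x y hxy => by rw [hc, hc]; exact hL x y hxy) hlow
      simp only [hc] at this
      rw [prod_eq_mul_mul_prod_erase hpq.ne, hp, hq,
        Finset.prod_congr rfl (fun x hx => by rw [ho x hx])] at this
      exact this
    exact hle (plucker_mul_mem_span _ _ (hL p q hpq.le) t ht)

/-- The straightening law: a product of minors is a combination of standard products with the
same column lengths. -/
theorem multiset_prod_plucker_mem_span {m : ℕ} (M : Multiset (Finset (Fin m))) :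
    (M.map plucker).prod ∈ Submodule.span ℂ
      {f | ∃ S : Multiset (Finset (Fin m)), S.map Finset.card = M.map Finset.card ∧
        IsStandard S ∧ f = (S.map plucker).prod} := by
  classical
  obtain ⟨l₀, rfl⟩ := Quot.exists_rep M
  let r : Finset (Fin m) → Finset (Fin m) → Prop := fun I J => J.card ≤ I.card
  have : Std.Total r := ⟨fun I J => le_total _ _⟩
  have : IsTrans (Finset (Fin m)) r := ⟨fun I J K h1 h2 => le_trans h2 h1⟩
  have hperm := List.perm_insertionSort r l₀
  have hsort := List.pairwise_insertionSort r l₀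
  generalize List.insertionSort r l₀ = l at hperm hsort
  have hq : (Quot.mk _ l₀ : Multiset (Finset (Fin m))) = (l : Multiset (Finset (Fin m))) :=
    Quot.sound hperm.symm
  rw [hq]
  have hprod : ∀ S : Fin l.length → Finset (Fin m),
      (Multiset.map plucker (List.ofFn S : Multiset (Finset (Fin m)))).prod =
        ∏ x, plucker (S x) := by
    intro S
    rw [Multiset.map_coe, Multiset.prod_coe, List.map_ofFn, List.prod_ofFn]
    rfl
  have h1 := prod_plucker_mem_span (n := l.length) _ l.get
    (by
      intro p q hpq
      rcases hpq.eq_or_lt with rfl | h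
      · exact le_rfl
      · exact List.pairwise_iff_get.mp hsort p q h) (Nat.lt_succ_self _)
  rw [← hprod, List.ofFn_get] at h1
  refine Submodule.span_mono ?_ h1
  rintro _ ⟨S, hc, hs, rfl⟩
  refine ⟨List.ofFn S, ?_, ⟨_, rfl, ?_⟩, (hprod S).symm⟩
  · rw [Multiset.map_coe, Multiset.map_coe, List.map_ofFn]
    congr 1
    refine List.ext_get (by simp) ?_
    intro i h1 h2
    simpa using hc ⟨i, by simpa using h1⟩
  · rw [List.pairwise_ofFn]
    exact fun p q h => hs p q h

/-- In a list along which the natural-valued function `f` decreases, the values of `f` are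
determined by their multiset. -/
theorem map_eq_of_antitone {α : Type*} {l l' : List α} {f : α → ℕ}
    (hl : l.Pairwise (fun a b => f b ≤ f a)) (hl' : l'.Pairwise (fun a b => f b ≤ f a))
    (h : (l : Multiset α).map f = (l' : Multiset α).map f) : l.map f = l'.map f := by
  rw [Multiset.map_coe, Multiset.map_coe, Multiset.coe_eq_coe] at h
  exact h.eq_of_pairwise (le := fun a b => b ≤ a) (fun a b _ _ h1 h2 => le_antisymm h2 h1)
    (List.pairwise_map.mpr hl) (List.pairwise_map.mpr hl')

theorem IsStandard.eq_of_sameHeights {m : ℕ} {S T : Multiset (Finset (Fin m))} (hS : IsStandard S)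
    (hT : IsStandard T) (h : SameHeights S T) : S = T := by
  obtain ⟨l, rfl, hl⟩ := hS
  obtain ⟨l', rfl, hl'⟩ := hT
  have key : ∀ t, l.map (fun I => height I t) = l'.map (fun I => height I t) := fun t =>
    map_eq_of_antitone (hl.imp fun h => h t) (hl'.imp fun h => h t) (h t)
  congr 1
  have hlen : l.length = l'.length := by simpa using congrArg List.length (key 0)
  refine List.ext_getElem hlen fun i h1 h2 => eq_of_height_eq fun t _ => ?_
  have := List.getElem_of_eq (key t) (i := i) (by simpa using h1)
  simpa using this

/-! ### Leading terms of products of minors -/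

/-- The weight of an exponent vector in which `x_{s,v}` has weight `s * v`. By the rearrangement
inequality, the diagonal term of a minor is its unique term of largest weight. -/
noncomputable def diagWeight {m : ℕ} : (Fin m × Fin m →₀ ℕ) →+ ℕ :=
  Finsupp.weight fun p => (p.1 : ℕ) * (p.2 : ℕ)

/-- The monomial with exponent `d` occurs in `f` with coefficient `1`, and all other monomials of
`f` have a smaller weight. -/
def IsLead {m : ℕ} (f : MvPolynomial (Fin m × Fin m) ℂ) (d : Fin m × Fin m →₀ ℕ) : Prop :=
  f.coeff d = 1 ∧ ∀ d', f.coeff d' ≠ 0 → d' ≠ d → diagWeight d' < diagWeight d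

theorem isLead_one {m : ℕ} : IsLead (1 : MvPolynomial (Fin m × Fin m) ℂ) 0 := by
  classical
  refine ⟨by simp, fun d' h h' => absurd ?_ h⟩
  rw [MvPolynomial.coeff_one, if_neg (Ne.symm h')]

theorem IsLead.weight_le {m : ℕ} {f : MvPolynomial (Fin m × Fin m) ℂ} {d d' : Fin m × Fin m →₀ ℕ}
    (h : IsLead f d) (h' : f.coeff d' ≠ 0) : diagWeight d' ≤ diagWeight d := by
  by_cases hd : d' = d
  · rw [hd]
  · exact (h.2 d' h' hd).le

theorem IsLead.mul {m : ℕ} {f g : MvPolynomial (Fin m × Fin m) ℂ} {d e : Fin m × Fin m →₀ ℕ}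
    (hf : IsLead f d) (hg : IsLead g e) : IsLead (f * g) (d + e) := by
  classical
  have lt : ∀ x y, f.coeff x * g.coeff y ≠ 0 → (x, y) ≠ (d, e) →
      diagWeight (x + y) < diagWeight (d + e) := by
    intro x y h hne
    have hx := left_ne_zero_of_mul h
    have hy := right_ne_zero_of_mul h
    rw [map_add, map_add]
    by_cases hxd : x = d
    · have hye : y ≠ e := fun hye => hne (by rw [hxd, hye])
      exact add_lt_add_of_le_of_lt (hf.weight_le hx) (hg.2 y hy hye)
    · exact add_lt_add_of_lt_of_le (hf.2 x hx hxd) (hg.weight_le hy)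
  constructor
  · rw [MvPolynomial.coeff_mul, Finset.sum_eq_single (d, e)]
    · rw [hf.1, hg.1, one_mul]
    · rintro ⟨x, y⟩ hxy hne
      by_contra h
      have := lt x y h hne
      rw [Finset.HasAntidiagonal.mem_antidiagonal.mp hxy] at this
      exact lt_irrefl _ this
    · intro h
      rw [Finset.HasAntidiagonal.mem_antidiagonal] at h
      exact absurd rfl h
  · intro d' h hne
    rw [MvPolynomial.coeff_mul] at h
    obtain ⟨⟨x, y⟩, hxy, h⟩ := Finset.exists_ne_zero_of_sum_ne_zero h
    have hxy' := Finset.HasAntidiagonal.mem_antidiagonal.mp hxy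
    simp only at hxy'
    rw [← hxy']
    refine lt x y h ?_
    rintro ⟨rfl, rfl⟩
    exact hne hxy'.symm

/-- The exponent of the diagonal term of the minor `x_I`. -/
noncomputable def diagExponent {m : ℕ} (I : Finset (Fin m)) : Fin m × Fin m →₀ ℕ :=
  ∑ i : Fin I.card, Finsupp.single
    (Fin.castLE (by simpa using I.card_le_univ : I.card ≤ m) i, I.orderEmbOfFin rfl i) 1

theorem isLead_plucker {m : ℕ} (I : Finset (Fin m)) : IsLead (plucker I) (diagExponent I) := by
  classical
  have hI : I.card ≤ m := by simpa using I.card_le_univ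
  let e := I.orderEmbOfFin rfl
  let D : Equiv.Perm (Fin I.card) → (Fin m × Fin m →₀ ℕ) := fun σ =>
    ∑ i, Finsupp.single (Fin.castLE hI (σ i), e i) 1
  have hD1 : diagExponent I = D 1 := rfl
  have hcoeff : ∀ d, (plucker I).coeff d =
      ∑ σ : Equiv.Perm (Fin I.card), if D σ = d then ((Equiv.Perm.sign σ : ℤ) : ℂ) else 0 := by
    intro d
    rw [plucker, Matrix.det_apply, MvPolynomial.coeff_sum]
    refine Finset.sum_congr rfl fun σ _ => ?_
    have : ∏ i, ((Matrix.mvPolynomialX (Fin m) (Fin m) ℂ).submatrix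
        (Fin.castLE hI) (I.orderEmbOfFin rfl)) (σ i) i = MvPolynomial.monomial (D σ) 1 := by
      rw [MvPolynomial.monomial_sum_one]
      rfl
    rw [this, Units.smul_def, ← Int.cast_smul_eq_zsmul ℂ, MvPolynomial.coeff_smul,
      MvPolynomial.coeff_monomial]
    split_ifs <;> simp
  have hweight : ∀ σ, diagWeight (D σ) = ∑ i, (σ i : ℕ) * (e i : ℕ) := by
    intro σ
    simp only [D, map_sum, diagWeight, Finsupp.weight_apply]
    refine Finset.sum_congr rfl fun i _ => ?_
    rw [Finsupp.sum_single_index] <;> simp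
  have hlt : ∀ σ, σ ≠ 1 → diagWeight (D σ) < diagWeight (D 1) := by
    intro σ hσ
    rw [hweight, hweight]
    have hmono : Monovary (fun i : Fin I.card => (i : ℕ)) (fun i => (e i : ℕ)) := fun i j hij =>
      (e.lt_iff_lt.mp (Fin.lt_def.mpr hij)).le
    refine hmono.sum_comp_perm_mul_lt_sum_mul_iff.mpr fun h => hσ ?_
    have hs : StrictMono σ := by
      refine Monotone.strictMono_of_injective (fun i j hij => ?_) σ.injective
      rcases hij.eq_or_lt with rfl | hij
      · exact le_rfl
      · exact Fin.le_def.mpr (h (Fin.lt_def.mp (e.lt_iff_lt.mpr hij)))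
    have := (hs.range_inj strictMono_id).mp (by simp [σ.surjective.range_eq])
    ext i
    simp [this]
  have hne : ∀ σ, σ ≠ 1 → D σ ≠ D 1 := fun σ hσ h => by
    have := hlt σ hσ
    rw [h] at this
    exact lt_irrefl _ this
  rw [hD1]
  constructor
  · rw [hcoeff, Finset.sum_eq_single 1]
    · simp
    · intro σ _ hσ
      rw [if_neg (hne σ hσ)]
    · simp
  · intro d hd hdne
    rw [hcoeff] at hd
    obtain ⟨σ, _, h⟩ := Finset.exists_ne_zero_of_sum_ne_zero hd
    have hσ : D σ = d := by
      by_contra h'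
      rw [if_neg h'] at h
      exact h rfl
    rw [← hσ]
    refine hlt σ ?_
    rintro rfl
    exact hdne hσ.symm

theorem isLead_prod {m : ℕ} (S : Multiset (Finset (Fin m))) :
    IsLead (S.map plucker).prod (S.map diagExponent).sum := by
  induction S using Multiset.induction with
  | empty => simpa using isLead_one
  | cons I S ih => simpa using (isLead_plucker I).mul ih

theorem linearIndependent_of_isLead {m : ℕ} {ι : Type*}
    (f : ι → MvPolynomial (Fin m × Fin m) ℂ) (d : ι → Fin m × Fin m →₀ ℕ)
    (hf : ∀ i, IsLead (f i) (d i)) (hd : Function.Injective d) : LinearIndependent ℂ f := by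
  classical
  rw [linearIndependent_iff']
  intro s g hg i hi
  by_contra hgi
  -- an index of largest weight among those with a nonzero coefficient
  obtain ⟨j, hj, hmax⟩ := (s.filter fun i => g i ≠ 0).exists_max_image (fun i => diagWeight (d i))
    ⟨i, by simp [hi, hgi]⟩
  have hj' := Finset.mem_filter.mp hj
  have h := congrArg (MvPolynomial.coeff (d j)) hg
  rw [MvPolynomial.coeff_sum, Finset.sum_eq_single j] at h
  · rw [MvPolynomial.coeff_smul, (hf j).1] at h
    exact hj'.2 (by simpa using h)
  · intro k hk hkj
    rw [MvPolynomial.coeff_smul]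
    by_cases hgk : g k = 0
    · rw [hgk, zero_smul]
    · have hle := hmax k (Finset.mem_filter.mpr ⟨hk, hgk⟩)
      by_contra hne
      have := (hf k).2 (d j) (fun h0 => hne (by rw [h0, smul_zero])) (fun h => hkj (hd h.symm))
      omega
  · exact fun h => absurd hj'.1 h

theorem height_orderEmbOfFin {m : ℕ} (I : Finset (Fin m)) (i : Fin I.card) :
    height I (I.orderEmbOfFin rfl i) = i := by
  have : I.filter (fun j : Fin m => (j : ℕ) < I.orderEmbOfFin rfl i) =
      (Finset.Iio i).map (I.orderEmbOfFin rfl).toEmbedding := by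
    ext j
    simp only [Finset.mem_filter, Finset.mem_map, Finset.mem_Iio, RelEmbedding.coe_toEmbedding]
    constructor
    · rintro ⟨hj, hlt⟩
      have : j ∈ Set.range (I.orderEmbOfFin rfl) := by rw [Finset.range_orderEmbOfFin]; exact hj
      obtain ⟨k, rfl⟩ := this
      exact ⟨k, (I.orderEmbOfFin rfl).lt_iff_lt.mp (Fin.lt_def.mpr hlt), rfl⟩
    · rintro ⟨k, hk, rfl⟩
      exact ⟨Finset.orderEmbOfFin_mem _ _ _,
        Fin.lt_def.mp ((I.orderEmbOfFin rfl).lt_iff_lt.mpr hk)⟩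
  rw [height, this, Finset.card_map, Fin.card_Iio]

theorem orderEmbOfFin_lt_iff {m : ℕ} (I : Finset (Fin m)) (i : Fin I.card) (t : ℕ) :
    (I.orderEmbOfFin rfl i : ℕ) < t ↔ (i : ℕ) < height I t := by
  have h := height_orderEmbOfFin I i
  constructor
  · intro hlt
    have h1 := height_mono I (Nat.succ_le_of_lt hlt)
    have h2 := (mem_iff_height I _).mp (Finset.orderEmbOfFin_mem I rfl i)
    simp only [Nat.succ_eq_add_one] at h1
    omega
  · intro hlt
    by_contra hle
    have := height_mono I (not_lt.mp hle)
    omega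

/-- The entries `< t` in row `s` of the diagonal exponent record whether `p(I)` makes more than `s`
north steps among its first `t` steps. -/
theorem sum_diagExponent {m : ℕ} (I : Finset (Fin m)) (s : Fin m) (t : ℕ) :
    ∑ v ∈ Finset.univ.filter (fun v : Fin m => (v : ℕ) < t), diagExponent I (s, v) =
      if (s : ℕ) < height I t then 1 else 0 := by
  classical
  have hI : I.card ≤ m := by simpa using I.card_le_univ
  have h1 : ∀ i : Fin I.card, ∑ v ∈ Finset.univ.filter (fun v : Fin m => (v : ℕ) < t),
      (Finsupp.single (Fin.castLE hI i, I.orderEmbOfFin rfl i) (1 : ℕ)) (s, v) =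
      if (i : ℕ) = s ∧ (i : ℕ) < height I t then 1 else 0 := by
    intro i
    rw [Finset.sum_filter, Finset.sum_eq_single (I.orderEmbOfFin rfl i)]
    · simp only [orderEmbOfFin_lt_iff, Finsupp.single_apply, Prod.mk.injEq, and_true, Fin.ext_iff,
        Fin.val_castLE]
      split_ifs <;> omega
    · intro v _ hv
      rw [Finsupp.single_apply, if_neg (fun h => hv (Prod.mk.inj h).2.symm), ite_self]
    · simp
  simp only [diagExponent, Finsupp.finsetSum_apply]
  rw [Finset.sum_comm, Finset.sum_congr rfl fun i _ => h1 i]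
  by_cases hs : (s : ℕ) < height I t
  · have hs' : (s : ℕ) < I.card := hs.trans_le (height_le_card I t)
    rw [if_pos hs, Finset.sum_eq_single ⟨s, hs'⟩]
    · simp [hs]
    · intro i _ hi
      rw [if_neg]
      rintro ⟨h, -⟩
      exact hi (Fin.ext h)
    · simp
  · rw [if_neg hs]
    refine Finset.sum_eq_zero fun i _ => if_neg ?_
    rintro ⟨h, h'⟩
    omega

/-- A multiset of natural numbers is determined by its size and the numbers of its elements above
each threshold. -/
theorem multiset_eq_of_countP {A B : Multiset ℕ} (h0 : A.card = B.card)
    (h : ∀ s, A.countP (s < ·) = B.countP (s < ·)) : A = B := by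
  have key : ∀ (C : Multiset ℕ) (n : ℕ), C.count n + C.countP (n < ·) = C.countP (n ≤ ·) := by
    intro C n
    rw [Multiset.count]
    induction C using Multiset.induction with
    | empty => simp
    | cons a C ih =>
      simp only [Multiset.countP_cons]
      split_ifs <;> omega
  have hle : ∀ n, A.countP (n ≤ ·) = B.countP (n ≤ ·) := by
    intro n
    cases n with
    | zero => simpa using h0
    | succ n => exact h n
  ext n
  have h1 := key A n
  have h2 := key B n
  rw [h n, hle n] at h1
  omega

theorem countP_height_eq_sum {m : ℕ} (S : Multiset (Finset (Fin m))) (s : Fin m) (t : ℕ) :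
    S.countP (fun I => (s : ℕ) < height I t) =
      ∑ v ∈ Finset.univ.filter (fun v : Fin m => (v : ℕ) < t), (S.map diagExponent).sum (s, v) := by
  induction S using Multiset.induction with
  | empty => simp
  | cons I S ih =>
    simp only [Multiset.map_cons, Multiset.sum_cons, Finsupp.add_apply, Finset.sum_add_distrib,
      sum_diagExponent, ← ih, Multiset.countP_cons]
    ring

/-- The leading exponent of a product of minors determines the heights of its columns, up to the
number of columns. -/
theorem sameHeights_of_diagExponent {m : ℕ} {S T : Multiset (Finset (Fin m))}
    (hc : S.card = T.card) (h : (S.map diagExponent).sum = (T.map diagExponent).sum) :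
    SameHeights S T := by
  intro t
  refine multiset_eq_of_countP (by simpa using hc) fun s => ?_
  rw [Multiset.countP_map, Multiset.countP_map, ← Multiset.countP_eq_card_filter,
    ← Multiset.countP_eq_card_filter]
  by_cases hs : s < m
  · have h1 := countP_height_eq_sum S ⟨s, hs⟩ t
    have h2 := countP_height_eq_sum T ⟨s, hs⟩ t
    rw [h] at h1
    exact h1.trans h2.symm
  · have : ∀ I : Finset (Fin m), ¬ s < height I t := fun I => by have := height_le' I t; omega
    rw [Multiset.countP_eq_zero.mpr fun I _ => this I,
      Multiset.countP_eq_zero.mpr fun I _ => this I]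

theorem card_eq_of_diagExponent {m : ℕ} {S T : Multiset (Finset (Fin m))}
    (hS : ∀ I ∈ S, I.Nonempty) (hT : ∀ I ∈ T, I.Nonempty)
    (h : (S.map diagExponent).sum = (T.map diagExponent).sum) : S.card = T.card := by
  rcases Nat.eq_zero_or_pos m with rfl | hm
  · have : ∀ S : Multiset (Finset (Fin 0)), (∀ I ∈ S, I.Nonempty) → S = 0 := by
      intro S hS
      refine Multiset.eq_zero_of_forall_notMem fun I hI => ?_
      obtain ⟨i, -⟩ := hS I hI
      exact i.elim0
    rw [this S hS, this T hT]
  · have key : ∀ S : Multiset (Finset (Fin m)), (∀ I ∈ S, I.Nonempty) →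
        S.card = ∑ v ∈ Finset.univ.filter (fun v : Fin m => (v : ℕ) < m),
          (S.map diagExponent).sum (⟨0, hm⟩, v) := by
      intro S hS
      rw [← countP_height_eq_sum, eq_comm, Multiset.countP_eq_card]
      intro I hI
      rw [height_of_le I le_rfl]
      exact (hS I hI).card_pos
    rw [key S hS, key T hT, h]

/-! ### Vertices, tableaux and the monomial basis -/

section Basis

theorem pathNode_eq {m : ℕ} (I : Finset (Fin m)) (t : ℕ) :
    pathNode I t = ((t : ℤ) - height I t, (height I t : ℤ)) := rfl

theorem forall_pathNode_mem_iff {m : ℕ} {a : Finset (Fin (m + 1))} (I : Finset (Fin m)) :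
    (∀ t ≤ m, pathNode I t ∈ nodes m a) ↔ ∃ k ∈ a, I.card = (k : ℕ) := by
  constructor
  · intro h
    obtain ⟨k, hk, h1, h2, h3, h4⟩ := h m le_rfl
    rw [pathNode_eq, height_of_le I le_rfl] at h2 h4
    simp only at h2 h4
    exact ⟨k, hk, by omega⟩
  · rintro ⟨k, hk, hIk⟩ t ht
    have h1 := height_le I t
    have h2 := height_le_card I t
    have h3 := height_add_le I t (m - t)
    rw [height_of_le I (by omega)] at h3
    refine ⟨k, hk, ?_⟩
    rw [pathNode_eq]
    simp only
    omega

theorem Vertex.card_mem {m : ℕ} {a : Finset (Fin (m + 1))} (I : Vertex m a) :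
    ∃ k ∈ a, I.1.card = (k : ℕ) := (forall_pathNode_mem_iff I.1).mp I.2

/-- A multiset of columns whose sizes occur in a multiset of vertices consists of vertices. -/
theorem exists_map_val_eq {m : ℕ} {a : Finset (Fin (m + 1))} (M : Multiset (Vertex m a))
    (S : Multiset (Finset (Fin m)))
    (h : S.map Finset.card = (M.map Subtype.val).map Finset.card) :
    ∃ S' : Multiset (Vertex m a), S'.map Subtype.val = S := by
  have hS : ∀ I ∈ S, ∀ t ≤ m, pathNode I t ∈ nodes m a := by
    intro I hI
    have : I.card ∈ S.map Finset.card := Multiset.mem_map_of_mem _ hI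
    rw [h, Multiset.map_map] at this
    obtain ⟨J, -, hJ⟩ := Multiset.mem_map.mp this
    rw [forall_pathNode_mem_iff, ← hJ]
    exact Vertex.card_mem J
  lift S to Multiset (Vertex m a) using hS
  exact ⟨S, rfl⟩

theorem IsLead.unique {m : ℕ} {f : MvPolynomial (Fin m × Fin m) ℂ} {d e : Fin m × Fin m →₀ ℕ}
    (hd : IsLead f d) (he : IsLead f e) : d = e := by
  by_contra hne
  have h1 := hd.2 e (by rw [he.1]; exact one_ne_zero) (Ne.symm hne)
  have h2 := he.2 d (by rw [hd.1]; exact one_ne_zero) hne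
  omega

theorem plucker_empty {m : ℕ} : plucker (∅ : Finset (Fin m)) = 1 := by
  have : IsEmpty (Fin (∅ : Finset (Fin m)).card) := by rw [Finset.card_empty]; infer_instance
  exact Matrix.det_isEmpty

theorem diagExponent_empty {m : ℕ} : diagExponent (∅ : Finset (Fin m)) = 0 := by
  have : IsEmpty (Fin (∅ : Finset (Fin m)).card) := by rw [Finset.card_empty]; infer_instance
  exact Finset.sum_of_isEmpty _

/-- Every multiset of columns has the same heights as exactly one tableau. For the monomials to
form a basis, this is all that is needed of a triangulation. -/
def HasUniqueTableaux {m : ℕ} (a : Finset (Fin (m + 1)))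
    (c : Finset (Fin m) → Finset (Fin m) → Prop) : Prop :=
  (∀ S : Multiset (Vertex m a), ∃ T : Tableau a c,
    SameHeights (S.map Subtype.val) (T.1.map Subtype.val)) ∧
  ∀ T T' : Tableau a c, SameHeights (T.1.map Subtype.val) (T'.1.map Subtype.val) → T = T'

variable {m : ℕ} {a : Finset (Fin (m + 1))} {c : Finset (Fin m) → Finset (Fin m) → Prop}

theorem Tableau.monomial_eq (T : Tableau a c) :
    T.monomial = ((T.1.map Subtype.val).map plucker).prod := by
  rw [Multiset.map_map]; rfl

open Classical in
/-- The tableau without its empty columns. -/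
noncomputable def Tableau.nonemptyPart (T : Tableau a c) : Tableau a c :=
  ⟨T.1.filter fun I => I.1.Nonempty,
    T.2.mono fun _ hI => Multiset.mem_of_mem_filter hI⟩

/-- Empty columns do not contribute to a product over the columns. -/
theorem Tableau.prod_nonemptyPart {M : Type*} [CommMonoid M] (T : Tableau a c)
    (f : Finset (Fin m) → M) (hf : f ∅ = 1) :
    ((T.nonemptyPart.1.map Subtype.val).map f).prod = ((T.1.map Subtype.val).map f).prod := by
  classical
  conv_rhs => rw [← Multiset.filter_add_not (fun I : Vertex m a => I.1.Nonempty) T.1]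
  rw [Multiset.map_add, Multiset.map_add, Multiset.prod_add]
  have : (((T.1.filter fun I => ¬ I.1.Nonempty).map Subtype.val).map f).prod = 1 := by
    refine Multiset.prod_eq_one fun x hx => ?_
    simp only [Multiset.mem_map, Multiset.mem_filter, Finset.not_nonempty_iff_eq_empty] at hx
    obtain ⟨_, ⟨I, ⟨-, hI⟩, rfl⟩, rfl⟩ := hx
    rw [hI, hf]
  rw [this, mul_one, Tableau.nonemptyPart]

theorem Tableau.sum_nonemptyPart (T : Tableau a c) :
    ((T.nonemptyPart.1.map Subtype.val).map diagExponent).sum =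
      ((T.1.map Subtype.val).map diagExponent).sum :=
  T.prod_nonemptyPart (M := Multiplicative (Fin m × Fin m →₀ ℕ)) diagExponent diagExponent_empty

theorem HasUniqueTableaux.nonemptyPart_eq (h : HasUniqueTableaux a c) {T T' : Tableau a c}
    (he : ((T.1.map Subtype.val).map diagExponent).sum =
      ((T'.1.map Subtype.val).map diagExponent).sum) : T.nonemptyPart = T'.nonemptyPart := by
  rw [← T.sum_nonemptyPart, ← T'.sum_nonemptyPart] at he
  have hne : ∀ T : Tableau a c, ∀ I ∈ T.nonemptyPart.1.map Subtype.val, I.Nonempty := by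
    intro T I hI
    obtain ⟨J, hJ, rfl⟩ := Multiset.mem_map.mp hI
    exact (Multiset.mem_filter.mp hJ).2
  exact h.2 _ _ (sameHeights_of_diagExponent (card_eq_of_diagExponent (hne T) (hne T') he) he)

theorem nonemptyPart_eq_iff (T T' : Tableau a c) : T.nonemptyPart = T'.nonemptyPart ↔
    ∀ I : Vertex m a, I.1.Nonempty → T.1.count I = T'.1.count I := by
  classical
  constructor
  · intro h I hI
    have := congrArg (fun T => T.1.count I) h
    simp only [Tableau.nonemptyPart, Multiset.count_filter, hI, if_true] at this
    convert this
  · intro h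
    refine Subtype.ext (Multiset.ext.mpr fun I => ?_)
    simp only [Tableau.nonemptyPart, Multiset.count_filter]
    split_ifs with hI
    · convert h I hI
    · rfl

theorem HasUniqueTableaux.monomial_eq_iff (h : HasUniqueTableaux a c) (T T' : Tableau a c) :
    T.monomial = T'.monomial ↔
      ∀ I : Vertex m a, I.1.Nonempty → T.1.count I = T'.1.count I := by
  rw [← nonemptyPart_eq_iff]
  constructor
  · intro hm
    rw [T.monomial_eq, T'.monomial_eq] at hm
    refine h.nonemptyPart_eq (IsLead.unique (isLead_prod _) ?_)
    rw [hm]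
    exact isLead_prod _
  · intro hn
    rw [T.monomial_eq, T'.monomial_eq, ← T.prod_nonemptyPart _ plucker_empty,
      ← T'.prod_nonemptyPart _ plucker_empty, hn]

theorem HasUniqueTableaux.linearIndepOn (h : HasUniqueTableaux a c) :
    LinearIndepOn ℂ id (Set.range (Tableau.monomial : Tableau a c → _)) := by
  choose T hT using fun x : Set.range (Tableau.monomial : Tableau a c → _) => x.2
  refine linearIndependent_of_isLead _
    (fun x => (((T x).1.map Subtype.val).map diagExponent).sum) ?_ ?_
  · intro x
    have := isLead_prod ((T x).1.map Subtype.val)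
    rw [← Tableau.monomial_eq, hT x] at this
    exact this
  · intro x y hxy
    refine Subtype.ext ?_
    rw [← hT x, ← hT y, h.monomial_eq_iff, ← nonemptyPart_eq_iff]
    exact h.nonemptyPart_eq hxy

theorem finite_isStandard (ρ : Multiset ℕ) :
    {S : Multiset (Finset (Fin m)) | IsStandard S ∧ S.map Finset.card = ρ}.Finite := by
  refine (Set.finite_range (fun s : Sym (Finset (Fin m)) (Multiset.card ρ) => s.1)).subset ?_
  rintro S ⟨-, hS⟩
  exact ⟨⟨S, by rw [← hS, Multiset.card_map]⟩, rfl⟩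

/-- Any product of minors is a combination of monomials of tableaux. By the straightening law it
lies in the span of the standard products with the same column lengths. Replacing each standard
multiset of columns by the tableau with the same heights gives equally many monomials in this span,
and these are linearly independent, so they span it, too. -/
theorem HasUniqueTableaux.prod_mem_span (h : HasUniqueTableaux a c) (M : Multiset (Vertex m a)) :
    ((M.map Subtype.val).map plucker).prod ∈
      Submodule.span ℂ (Set.range (Tableau.monomial : Tableau a c → _)) := by
  let Std := {S : Multiset (Finset (Fin m)) |
    IsStandard S ∧ S.map Finset.card = (M.map Subtype.val).map Finset.card}
  have : Fintype Std := (finite_isStandard _).fintype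
  have hex : ∀ S : Std, ∃ T : Tableau a c, SameHeights S.1 (T.1.map Subtype.val) := by
    rintro ⟨S, -, hS⟩
    obtain ⟨S', rfl⟩ := exists_map_val_eq M S hS
    exact h.1 S'
  choose T hT using hex
  let f : Std → MvPolynomial (Fin m × Fin m) ℂ := fun S => (S.1.map plucker).prod
  let g : Std → MvPolynomial (Fin m × Fin m) ℂ := fun S => (T S).monomial
  have hsize : ∀ S, ((T S).1.map Subtype.val).map Finset.card =
      (M.map Subtype.val).map Finset.card := fun S => (hT S).map_card.symm.trans S.2.2
  have hstraight : ∀ N : Multiset (Finset (Fin m)),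
      N.map Finset.card = (M.map Subtype.val).map Finset.card →
      (N.map plucker).prod ∈ Submodule.span ℂ (Set.range f) := by
    intro N hN
    refine Submodule.span_mono ?_ (multiset_prod_plucker_mem_span N)
    rintro _ ⟨S, h1, h2, rfl⟩
    exact ⟨⟨S, h2, h1.trans hN⟩, rfl⟩
  have hli : LinearIndependent ℂ g := by
    refine linearIndependent_of_isLead g
      (fun S => (((T S).1.map Subtype.val).map diagExponent).sum) ?_ ?_
    · intro S
      have := isLead_prod ((T S).1.map Subtype.val)
      rwa [← Tableau.monomial_eq] at this
    · intro S S' hSS'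
      have hc : ((T S).1.map Subtype.val).card = ((T S').1.map Subtype.val).card := by
        have := congrArg Multiset.card ((hsize S).trans (hsize S').symm)
        rwa [Multiset.card_map, Multiset.card_map _ ((T S').1.map Subtype.val)] at this
      exact Subtype.ext (S.2.1.eq_of_sameHeights S'.2.1
        ((hT S).trans ((sameHeights_of_diagExponent hc hSS').trans (hT S').symm)))
  have hle : Submodule.span ℂ (Set.range g) ≤ Submodule.span ℂ (Set.range f) := by
    rw [Submodule.span_le]
    rintro _ ⟨S, rfl⟩
    have := hstraight _ (hsize S)
    rwa [← Tableau.monomial_eq] at this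
  have : FiniteDimensional ℂ (Submodule.span ℂ (Set.range f)) :=
    FiniteDimensional.span_of_finite ℂ (Set.finite_range f)
  have heq : Submodule.span ℂ (Set.range g) = Submodule.span ℂ (Set.range f) := by
    refine Submodule.eq_of_le_of_finrank_le hle ?_
    rw [finrank_span_eq_card hli]
    exact finrank_range_le_card f
  have hM := hstraight (M.map Subtype.val) rfl
  rw [← heq] at hM
  refine Submodule.span_mono ?_ hM
  rintro _ ⟨S, rfl⟩
  exact ⟨T S, rfl⟩

theorem HasUniqueTableaux.monomialsFormBasis (h : HasUniqueTableaux a c) :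
    MonomialsFormBasis a c where
  linearIndependent := h.linearIndepOn
  span_eq := by
    apply le_antisymm
    · rw [Submodule.span_le]
      rintro _ ⟨T, rfl⟩
      refine Subalgebra.multiset_prod_mem _ fun x hx => ?_
      obtain ⟨I, -, rfl⟩ := Multiset.mem_map.mp hx
      exact Algebra.subset_adjoin ⟨I.1, Vertex.card_mem I, rfl⟩
    · rw [pluckerAlgebra, Algebra.adjoin_eq_span, Submodule.span_le]
      intro x hx
      obtain ⟨l, hl, rfl⟩ := Submonoid.exists_multiset_of_mem_closure hx
      have : ∃ M : Multiset (Vertex m a), (M.map Subtype.val).map plucker = l := by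
        clear hx
        induction l using Multiset.induction with
        | empty => exact ⟨0, rfl⟩
        | cons f l ih =>
          obtain ⟨M, hM⟩ := ih fun y hy => hl y (Multiset.mem_cons_of_mem hy)
          obtain ⟨I, hI, rfl⟩ := hl f (Multiset.mem_cons_self _ _)
          refine ⟨⟨I, (forall_pathNode_mem_iff I).mpr hI⟩ ::ₘ M, ?_⟩
          simp only [Multiset.map_cons, hM]
      obtain ⟨M, rfl⟩ := this
      exact h.prod_mem_span M
  monomial_eq_iff := h.monomial_eq_iff

end Basis

/-! ### Gelfand-Tsetlin patterns of multisets of columns -/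

section Patterns

variable {m : ℕ} {a : Finset (Fin (m + 1))} {c : Finset (Fin m) → Finset (Fin m) → Prop}

/-- The northwest and southeast corners of a cell of `L` lie on an antidiagonal `x + y = t` with
`0 ≤ t ≤ m`, and a cell has coordinates at least `-1`. -/
theorem exists_antidiagonal (z : cells (nodes m a)) :
    ∃ t : ℕ, (t : ℤ) = z.1.1 + z.1.2 + 1 ∧ t ≤ m ∧ -1 ≤ z.1.1 ∧ -1 ≤ z.1.2 := by
  obtain ⟨⟨x, y⟩, h | h⟩ := z <;> obtain ⟨k, -, h1, h2, h3, h4⟩ := h <;> simp only at h1 h2 h3 h4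
  · exact ⟨(x + y + 1).toNat, by simp only; omega, by omega, by simp only; omega,
      by simp only; omega⟩
  · exact ⟨(x + y + 1).toNat, by simp only; omega, by omega, by simp only; omega,
      by simp only; omega⟩

theorem pathPattern_eq (I : Vertex m a) (z : cells (nodes m a)) (t : ℕ)
    (ht : (t : ℤ) = z.1.1 + z.1.2 + 1) (htm : t ≤ m) :
    pathPattern I z = if z.1.2 + 1 ≤ (height I.1 t : ℤ) then 1 else 0 := by
  classical
  have : (∃ t ≤ m, (pathNode I.1 t).1 ≤ z.1.1 ∧ z.1.2 + 1 ≤ (pathNode I.1 t).2) ↔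
      z.1.2 + 1 ≤ (height I.1 t : ℤ) := by
    simp only [pathNode_eq]
    constructor
    · rintro ⟨t', -, h1, h2⟩
      rcases le_total t' t with h | h
      · have := height_mono I.1 h
        omega
      · have := height_add_le I.1 t (t' - t)
        rw [Nat.add_sub_cancel' h] at this
        omega
    · intro h
      exact ⟨t, htm, by omega, h⟩
  rw [pathPattern]
  exact if_congr this rfl rfl

theorem isGTPattern_pathPattern (I : Vertex m a) :
    IsGTPattern (nodes m a) (pathPattern I) where
  nonneg z := by rw [pathPattern]; split_ifs <;> norm_num
  row z z' h h' := by
    obtain ⟨t, ht, htm, -⟩ := exists_antidiagonal z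
    obtain ⟨t', ht', htm', -⟩ := exists_antidiagonal z'
    rw [pathPattern_eq I z t ht htm, pathPattern_eq I z' t' ht' htm']
    have := height_mono I.1 (show t ≤ t' by omega)
    split_ifs <;> first | omega | norm_num
  col z z' h h' := by
    obtain ⟨t, ht, htm, -⟩ := exists_antidiagonal z
    obtain ⟨t', ht', htm', -⟩ := exists_antidiagonal z'
    rw [pathPattern_eq I z t ht htm, pathPattern_eq I z' t' ht' htm']
    have := height_add_le I.1 t' (t - t')
    rw [Nat.add_sub_cancel' (by omega)] at this
    split_ifs <;> first | omega | norm_num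
  connected z z' h := by
    obtain ⟨t, ht, htm, -⟩ := exists_antidiagonal z
    obtain ⟨t', ht', htm', -⟩ := exists_antidiagonal z'
    rw [pathPattern_eq I z t ht htm, pathPattern_eq I z' t' ht' htm']
    have h0 := I.2 t htm
    have h1 := I.2 t' htm'
    rw [pathNode_eq] at h0 h1
    -- if the entries differed, the path would use the edge that separates the cells
    rcases h with ⟨hz, -, -, hne⟩ | ⟨hz, -, -, hne⟩
    · have hz1 : z'.1.1 = z.1.1 + 1 := by rw [hz]
      have hz2 : z'.1.2 = z.1.2 := by rw [hz]
      obtain rfl : t' = t + 1 := by omega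
      have e1 := height_mono I.1 (Nat.le_succ t)
      have e2 := height_succ_le I.1 t
      simp only [Nat.succ_eq_add_one] at e1
      refine if_congr ?_ rfl rfl
      rw [hz2]
      constructor
      · intro; omega
      · intro h
        by_contra h'
        refine hne ⟨?_, ?_⟩
        · convert h0 using 2 <;> omega
        · convert h1 using 2 <;> push_cast <;> omega
    · have hz1 : z'.1.1 = z.1.1 := by rw [hz]
      have hz2 : z'.1.2 = z.1.2 + 1 := by rw [hz]
      obtain rfl : t' = t + 1 := by omega
      have e1 := height_mono I.1 (Nat.le_succ t)
      have e2 := height_succ_le I.1 t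
      simp only [Nat.succ_eq_add_one] at e1
      refine if_congr ?_ rfl rfl
      rw [hz2]
      constructor
      · intro h
        by_contra h'
        refine hne ⟨?_, ?_⟩
        · convert h0 using 2 <;> omega
        · convert h1 using 2 <;> push_cast <;> omega
      · intro; omega
  west z h h' := by
    obtain ⟨t, ht, htm, h1, h2⟩ := exists_antidiagonal z
    rw [pathPattern_eq I z t ht htm]
    have := height_le I.1 t
    rw [if_neg (by omega)]

theorem IsGTPattern.zero {L : Set (ℤ × ℤ)} : IsGTPattern L (fun _ => 0) where
  nonneg _ := le_rfl
  row _ _ _ _ := le_rfl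
  col _ _ _ _ := le_rfl
  connected _ _ _ := rfl
  west _ _ _ := rfl

theorem IsGTPattern.add {L : Set (ℤ × ℤ)} {T T' : cells L → ℝ} (h : IsGTPattern L T)
    (h' : IsGTPattern L T') : IsGTPattern L (fun z => T z + T' z) where
  nonneg z := add_nonneg (h.nonneg z) (h'.nonneg z)
  row z z' h1 h2 := add_le_add (h.row z z' h1 h2) (h'.row z z' h1 h2)
  col z z' h1 h2 := add_le_add (h.col z z' h1 h2) (h'.col z z' h1 h2)
  connected z z' h1 := by rw [h.connected z z' h1, h'.connected z z' h1]
  west z h1 h2 := by rw [h.west z h1 h2, h'.west z h1 h2, add_zero]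

/-- The Gelfand-Tsetlin pattern of a multiset of columns: the sum of the patterns of their paths. -/
noncomputable def multisetPattern (S : Multiset (Vertex m a)) (z : cells (nodes m a)) : ℝ :=
  (S.map fun I => pathPattern I z).sum

theorem isGTPattern_multisetPattern (S : Multiset (Vertex m a)) :
    IsGTPattern (nodes m a) (multisetPattern S) := by
  induction S using Multiset.induction with
  | empty => exact IsGTPattern.zero
  | cons I S ih =>
    convert (isGTPattern_pathPattern I).add ih using 2 with z
    simp [multisetPattern]

theorem multisetPattern_eq_countP (S : Multiset (Vertex m a)) (z : cells (nodes m a)) (t : ℕ)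
    (ht : (t : ℤ) = z.1.1 + z.1.2 + 1) (htm : t ≤ m) :
    multisetPattern S z =
      ((S.map Subtype.val).countP fun I => z.1.2 + 1 ≤ (height I t : ℤ) : ℕ) := by
  induction S using Multiset.induction with
  | empty => simp [multisetPattern]
  | cons I S ih =>
    rw [multisetPattern] at ih ⊢
    rw [Multiset.map_cons, Multiset.sum_cons, ih, pathPattern_eq I z t ht htm, Multiset.map_cons,
      Multiset.countP_cons]
    split_ifs <;> push_cast <;> ring

open Classical in
theorem multisetPattern_eq_sum (S : Multiset (Vertex m a)) (z : cells (nodes m a)) :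
    multisetPattern S z = ∑ I, (S.count I : ℝ) * pathPattern I z := by
  rw [multisetPattern, Finset.sum_multiset_map_count]
  simp only [nsmul_eq_mul]
  refine Finset.sum_subset (Finset.subset_univ _) fun I _ hI => ?_
  rw [Multiset.count_eq_zero.mpr (by simpa using hI)]
  simp

theorem multisetPattern_eq_of_sameHeights {S T : Multiset (Vertex m a)}
    (h : SameHeights (S.map Subtype.val) (T.map Subtype.val)) :
    multisetPattern S = multisetPattern T := by
  ext z
  obtain ⟨t, ht, htm, -⟩ := exists_antidiagonal z
  rw [multisetPattern_eq_countP S z t ht htm, multisetPattern_eq_countP T z t ht htm]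
  have key : ∀ S : Multiset (Vertex m a),
      ((S.map Subtype.val).countP fun I => z.1.2 + 1 ≤ (height I t : ℤ)) =
      ((S.map Subtype.val).map fun I => height I t).countP fun n : ℕ => z.1.2 + 1 ≤ (n : ℤ) := by
    intro S
    rw [Multiset.countP_map _ (S.map Subtype.val), ← Multiset.countP_eq_card_filter]
  rw [key S, key T, h t]

theorem countP_eq_of_multisetPattern_eq {S T : Multiset (Vertex m a)}
    (h : multisetPattern S = multisetPattern T) {s t : ℕ} (htm : t ≤ m)
    (hz : ((t : ℤ) - s, (s : ℤ) - 1) ∈ cells (nodes m a)) :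
    (S.map Subtype.val).countP (fun I => s ≤ height I t) =
      (T.map Subtype.val).countP (fun I => s ≤ height I t) := by
  have h1 := congrFun h ⟨_, hz⟩
  rw [multisetPattern_eq_countP S _ t (by simp) htm, multisetPattern_eq_countP T _ t (by simp) htm,
    Nat.cast_inj] at h1
  simpa using h1

theorem countP_val_congr (S : Multiset (Vertex m a)) {p : Finset (Fin m) → Prop}
    (q : Finset (Fin m) → Prop) [DecidablePred p] [DecidablePred q]
    (h : ∀ I : Vertex m a, p I.1 ↔ q I.1) :
    (S.map Subtype.val).countP p = (S.map Subtype.val).countP q := by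
  refine Multiset.countP_congr rfl fun I hI => ?_
  obtain ⟨J, -, rfl⟩ := Multiset.mem_map.mp hI
  exact propext (h J)

/-- A pattern determines the heights of the columns. A position without a cell lies between two
consecutive sinks, and there the number of paths above it is the number of paths that end in the
upper ones of the sinks. -/
theorem sameHeights_of_multisetPattern_eq {S T : Multiset (Vertex m a)}
    (h : multisetPattern S = multisetPattern T) :
    SameHeights (S.map Subtype.val) (T.map Subtype.val) := by
  have hcard : (S.map Subtype.val).card = (T.map Subtype.val).card := by
    rcases a.eq_empty_or_nonempty with rfl | ⟨k, hk⟩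
    · have : ∀ S : Multiset (Vertex m ∅), S = 0 := fun S =>
        Multiset.eq_zero_of_forall_notMem fun I _ => by
          obtain ⟨k, hk, -⟩ := Vertex.card_mem I
          simp at hk
      rw [this S, this T]
    · have := countP_eq_of_multisetPattern_eq h (s := 0) (t := 0) (Nat.zero_le m)
        (Or.inl ⟨k, hk, by simp; omega⟩)
      simpa using this
  have hend : ∀ s, (S.map Subtype.val).countP (fun I => s < height I m) =
      (T.map Subtype.val).countP (fun I => s < height I m) := by
    intro s
    -- a path has more than `s` north steps iff it ends in the first sink above `s` or beyond
    by_cases hs : ∃ k, ∃ hk : k < m + 1, (⟨k, hk⟩ : Fin (m + 1)) ∈ a ∧ s < k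
    · classical
      obtain ⟨hk, hka, hsk⟩ := Nat.find_spec hs
      have hmin := fun k => Nat.find_min' hs (m := k)
      set k := Nat.find hs
      have e : ∀ I : Vertex m a, s < height I.1 m ↔ k ≤ height I.1 m := by
        intro I
        rw [height_of_le I.1 le_rfl]
        refine ⟨fun hI => ?_, fun hI => hsk.trans_le hI⟩
        obtain ⟨k', hk', hIk⟩ := Vertex.card_mem I
        rw [hIk] at hI ⊢
        exact hmin k' ⟨k'.2, hk', hI⟩
      rw [countP_val_congr S (fun I => Nat.find hs ≤ height I m) e,
        countP_val_congr T (fun I => Nat.find hs ≤ height I m) e]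
      exact countP_eq_of_multisetPattern_eq h le_rfl (Or.inl ⟨_, hka, by dsimp only; omega⟩)
    · have e : ∀ I : Vertex m a, s < height I.1 m ↔ False := by
        intro I
        rw [height_of_le I.1 le_rfl, iff_false]
        intro hI
        obtain ⟨k', hk', hIk⟩ := Vertex.card_mem I
        exact hs ⟨k', k'.2, hk', hIk ▸ hI⟩
      rw [countP_val_congr S (fun _ => False) e, countP_val_congr T (fun _ => False) e]
      simp
  have hmid : ∀ s t, t ≤ m → (S.map Subtype.val).countP (fun I => s < height I t) =
      (T.map Subtype.val).countP (fun I => s < height I t) := by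
    intro s t ht
    rcases Nat.lt_or_ge s t with hst | hst
    · by_cases hk : ∃ k ∈ a, s < (k : ℕ) ∧ t + k ≤ m + s + 1
      · obtain ⟨k, hk, h1, h2⟩ := hk
        exact countP_eq_of_multisetPattern_eq h (s := s + 1) ht
          (Or.inl ⟨k, hk, by simp; omega⟩)
      · have e : ∀ I : Vertex m a, s < height I.1 t ↔ s < height I.1 m := by
          intro I
          rw [height_of_le I.1 le_rfl]
          refine ⟨fun hI => hI.trans_le (height_le_card I.1 t), fun hI => ?_⟩
          obtain ⟨k, hka, hIk⟩ := Vertex.card_mem I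
          have h1 := height_add_le I.1 t (m - t)
          rw [Nat.add_sub_cancel' ht, height_of_le I.1 le_rfl] at h1
          by_contra hlt
          exact hk ⟨k, hka, by omega, by omega⟩
        rw [countP_val_congr S (fun I => s < height I m) e,
        countP_val_congr T (fun I => s < height I m) e]
        exact hend s
    · have e : ∀ I : Vertex m a, s < height I.1 t ↔ False := by
        intro I
        have := height_le I.1 t
        rw [iff_false]
        omega
      rw [countP_val_congr S (fun _ => False) e, countP_val_congr T (fun _ => False) e]
      simp
  intro t
  refine multiset_eq_of_countP (by simpa using hcard) fun s => ?_
  rw [Multiset.countP_map _ (S.map Subtype.val), Multiset.countP_map _ (T.map Subtype.val),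
    ← Multiset.countP_eq_card_filter, ← Multiset.countP_eq_card_filter]
  rcases le_total t m with ht | ht
  · exact hmid s t ht
  · simp only [height_of_le _ ht, ← height_of_le _ (le_refl m)]
    exact hend s

open Classical in
theorem isDecomposition_count (T : Tableau a c) :
    IsDecomposition c (multisetPattern T.1) (fun I => (T.1.count I : ℝ)) := by
  refine ⟨fun I => Nat.cast_nonneg _, T.2.mono fun I hI => ?_, multisetPattern_eq_sum T.1⟩
  simp only [Set.mem_ofPred_eq, ne_eq, Nat.cast_eq_zero] at hI
  exact Multiset.count_ne_zero.mp hI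

/-- If the complex triangulates `GT_L` integrally, then the unique decomposition of the pattern of
a multiset of columns is a tableau. -/
theorem hasUniqueTableaux_of_triangulates (ht : Triangulates a c) (hi : IsIntegral a c) :
    HasUniqueTableaux a c := by
  classical
  constructor
  · intro S
    have hS := isGTPattern_multisetPattern S
    obtain ⟨w, hw, -⟩ := ht _ hS
    have hint : ∀ z, ∃ n : ℕ, multisetPattern S z = n := by
      intro z
      obtain ⟨t, h1, h2, -⟩ := exists_antidiagonal z
      exact ⟨_, multisetPattern_eq_countP S z t h1 h2⟩
    choose n hn using hi _ hS hint w hw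
    let T : Multiset (Vertex m a) := ∑ I, Multiset.replicate (n I) I
    have hcount : ∀ I, T.count I = n I := by
      intro I
      simp only [T, Multiset.count_sum', Multiset.count_replicate]
      simp
    refine ⟨⟨T, hw.2.1.mono fun I hI => ?_⟩, sameHeights_of_multisetPattern_eq ?_⟩
    · rw [Set.mem_ofPred_eq, hn I, ← hcount I]
      exact_mod_cast Multiset.count_ne_zero.mpr hI
    · ext z
      rw [hw.2.2 z, multisetPattern_eq_sum]
      simp only [hcount, hn]
  · intro T T' h
    have h1 := isDecomposition_count T
    rw [multisetPattern_eq_of_sameHeights h] at h1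
    have h2 := (ht _ (isGTPattern_multisetPattern T'.1)).unique h1 (isDecomposition_count T')
    refine Subtype.ext (Multiset.ext.mpr fun I => ?_)
    exact_mod_cast congrFun h2 I

end Patterns

/-! ### Multisets of paths that avoid each other -/

/-- The heights of the path `p(I)` up to time `t`, as the digits of a number in base `m + 1`.
Comparing codes means comparing heights at the last time at which they differ. -/
def code {m : ℕ} (I : Finset (Fin m)) (t : ℕ) : ℕ :=
  ∑ r ∈ Finset.range (t + 1), height I r * (m + 1) ^ r

theorem code_zero {m : ℕ} (I : Finset (Fin m)) : code I 0 = 0 := by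
  simp [code, height_zero]

theorem code_succ {m : ℕ} (I : Finset (Fin m)) (t : ℕ) :
    code I (t + 1) = code I t + height I (t + 1) * (m + 1) ^ (t + 1) :=
  Finset.sum_range_succ _ _

theorem code_lt {m : ℕ} (I : Finset (Fin m)) (t : ℕ) : code I t < (m + 1) ^ (t + 1) := by
  induction t with
  | zero => simp [code_zero]
  | succ t ih =>
    rw [code_succ, pow_succ _ (t + 1)]
    have := Nat.mul_le_mul_right ((m + 1) ^ (t + 1)) (height_le' I (t + 1))
    nlinarith

theorem code_lt_code_iff {m : ℕ} (I J : Finset (Fin m)) (t : ℕ) :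
    code I t < code J t ↔
      ∃ q ≤ t, height I q < height J q ∧ ∀ p, q < p → p ≤ t → height I p = height J p := by
  induction t with
  | zero => simp [code_zero, height_zero]
  | succ t ih =>
    rw [code_succ, code_succ]
    have hI := code_lt I t
    have hJ := code_lt J t
    rcases lt_trichotomy (height I (t + 1)) (height J (t + 1)) with h | h | h
    · refine iff_of_true ?_ ⟨t + 1, le_rfl, h, fun p h1 h2 => by omega⟩
      have := Nat.mul_le_mul_right ((m + 1) ^ (t + 1)) (Nat.succ_le_of_lt h)
      rw [Nat.succ_mul] at this
      omega
    · rw [h, Nat.add_lt_add_iff_right, ih]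
      constructor
      · rintro ⟨q, hq, h1, h2⟩
        refine ⟨q, by omega, h1, fun p hp hpt => ?_⟩
        rcases Nat.lt_or_ge t p with h3 | h3
        · obtain rfl : p = t + 1 := by omega
          exact h
        · exact h2 p hp h3
      · rintro ⟨q, hq, h1, h2⟩
        have : q ≠ t + 1 := by rintro rfl; omega
        exact ⟨q, by omega, h1, fun p hp hpt => h2 p hp (by omega)⟩
    · refine iff_of_false ?_ ?_
      · have := Nat.mul_le_mul_right ((m + 1) ^ (t + 1)) (Nat.succ_le_of_lt h)
        rw [Nat.succ_mul] at this
        omega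
      · rintro ⟨q, hq, h1, h2⟩
        have : q ≠ t + 1 := by rintro rfl; omega
        have := h2 (t + 1) (by omega) le_rfl
        omega

theorem code_congr {m : ℕ} {I J : Finset (Fin m)} {t : ℕ}
    (h : ∀ r ≤ t, height I r = height J r) : code I t = code J t :=
  Finset.sum_congr rfl fun r hr => by rw [h r (by rw [Finset.mem_range] at hr; omega)]

theorem height_eq_of_code_eq {m : ℕ} {I J : Finset (Fin m)} {t : ℕ} (h : code I t = code J t) :
    ∀ r ≤ t, height I r = height J r := by
  induction t with
  | zero => intro r hr; rw [Nat.le_zero.mp hr, height_zero, height_zero]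
  | succ t ih =>
    rw [code_succ, code_succ] at h
    have hI := code_lt I t
    have hJ := code_lt J t
    have hh : height I (t + 1) = height J (t + 1) := by
      have h1 := congrArg (· / (m + 1) ^ (t + 1)) h
      rwa [Nat.add_mul_div_right _ _ (by positivity), Nat.add_mul_div_right _ _ (by positivity),
        Nat.div_eq_of_lt hI, Nat.div_eq_of_lt hJ, zero_add, zero_add] at h1
    rw [hh, Nat.add_right_cancel_iff] at h
    intro r hr
    rcases Nat.lt_or_ge t r with h3 | h3
    · obtain rfl : r = t + 1 := by omega
      exact hh
    · exact ih h r h3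

/-- Until time `t`, it does not happen that `p(J)` comes from above to meet `p(I)` and leaves it
again to the upper side. -/
def AvoidsUntil {m : ℕ} (t : ℕ) (I J : Finset (Fin m)) : Prop :=
  ∀ r < t, height I r = height J r → code I r < code J r → height J (r + 1) ≤ height I (r + 1)

/-- If `k` and `v` increase together on two multisets, then the joint distribution of `(k, v)` is
determined by the separate ones. -/
theorem map_prod_eq_of_comonotone {α β : Type*} [LinearOrder β] {S T : Multiset α} {k : α → β}
    {v : α → ℕ} (hS : ∀ a ∈ S, ∀ b ∈ S, k a < k b → v a ≤ v b)
    (hT : ∀ a ∈ T, ∀ b ∈ T, k a < k b → v a ≤ v b)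
    (hk : S.map k = T.map k) (hv : S.map v = T.map v) :
    S.map (fun a => (k a, v a)) = T.map (fun a => (k a, v a)) := by
  classical
  let r : α → α → Prop := fun a b => k a < k b ∨ k a = k b ∧ v a ≤ v b
  have : Std.Total r := ⟨fun a b => by
    rcases lt_trichotomy (k a) (k b) with h | h | h
    · exact Or.inl (Or.inl h)
    · rcases le_total (v a) (v b) with h' | h'
      · exact Or.inl (Or.inr ⟨h, h'⟩)
      · exact Or.inr (Or.inr ⟨h.symm, h'⟩)
    · exact Or.inr (Or.inl h)⟩
  have : IsTrans α r := ⟨fun a b c h1 h2 => by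
    rcases h1 with h1 | ⟨h1, h1'⟩ <;> rcases h2 with h2 | ⟨h2, h2'⟩
    · exact Or.inl (h1.trans h2)
    · exact Or.inl (h2 ▸ h1)
    · exact Or.inl (h1 ▸ h2)
    · exact Or.inr ⟨h1.trans h2, h1'.trans h2'⟩⟩
  have sorted : ∀ S : Multiset α, (∀ a ∈ S, ∀ b ∈ S, k a < k b → v a ≤ v b) →
      ∃ l : List α, (l : Multiset α) = S ∧ (l.map k).Pairwise (· ≤ ·) ∧
        (l.map v).Pairwise (· ≤ ·) := by
    intro S hS
    obtain ⟨l₀, rfl⟩ := Quot.exists_rep S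
    have hperm := List.perm_insertionSort r l₀
    refine ⟨List.insertionSort r l₀, Quot.sound hperm, ?_, ?_⟩
    · rw [List.pairwise_map]
      refine (List.pairwise_insertionSort r l₀).imp ?_
      rintro a b (h | ⟨h, -⟩)
      · exact h.le
      · exact h.le
    · rw [List.pairwise_map]
      refine (List.pairwise_insertionSort r l₀).imp_of_mem ?_
      rintro a b ha hb (h | ⟨-, h⟩)
      · exact hS a (hperm.mem_iff.mp ha) b (hperm.mem_iff.mp hb) h
      · exact h
  obtain ⟨l, rfl, h1, h2⟩ := sorted S hS
  obtain ⟨l', rfl, h1', h2'⟩ := sorted T hT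
  rw [Multiset.map_coe, Multiset.map_coe, Multiset.coe_eq_coe] at hk hv ⊢
  have e1 : l.map k = l'.map k := hk.eq_of_pairwise (fun a b _ _ => le_antisymm) h1 h1'
  have e2 : l.map v = l'.map v := hv.eq_of_pairwise (fun a b _ _ => le_antisymm) h2 h2'
  rw [← List.zip_map', ← List.zip_map', e1, e2]

/-- A multiset of columns whose paths pairwise avoid each other is determined by its heights: of
the paths that meet in a node, those with the smaller past are the ones that go north. -/
theorem eq_of_avoidsUntil {m : ℕ} {T T' : Multiset (Finset (Fin m))}
    (hT : ∀ I ∈ T, ∀ J ∈ T, AvoidsUntil m I J) (hT' : ∀ I ∈ T', ∀ J ∈ T', AvoidsUntil m I J)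
    (h : SameHeights T T') : T = T' := by
  have key : ∀ t ≤ m, T.map (fun I => (height I t, code I t)) =
      T'.map (fun I => (height I t, code I t)) := by
    intro t
    induction t with
    | zero =>
      intro _
      have := congrArg (Multiset.map fun n => (n, 0)) (h 0)
      simpa only [Multiset.map_map, Function.comp_def, code_zero] using this
    | succ t ih =>
      intro ht
      -- paths in higher nodes, and among those in one node the ones with the smaller past, are
      -- at least as high one step later
      let k : Finset (Fin m) → ℕ ×ₗ ℤ := fun I => toLex (height I t, -(code I t : ℤ))
      have hk : T.map k = T'.map k := by
        have := congrArg (Multiset.map fun p : ℕ × ℕ => toLex (p.1, -(p.2 : ℤ))) (ih (by omega))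
        simpa only [Multiset.map_map, Function.comp_def] using this
      have mono : ∀ T : Multiset (Finset (Fin m)), (∀ I ∈ T, ∀ J ∈ T, AvoidsUntil m I J) →
          ∀ I ∈ T, ∀ J ∈ T, k I < k J → height I (t + 1) ≤ height J (t + 1) := by
        intro T hT I hI J hJ hIJ
        rcases Prod.Lex.toLex_lt_toLex.mp hIJ with h | ⟨h1, h2⟩
        · have e1 := height_succ_le I t
          have e2 := height_mono J (Nat.le_succ t)
          simp only [Nat.succ_eq_add_one] at h e2
          omega
        · simp only at h1 h2
          exact hT J hJ I hI t (by omega) h1.symm (by omega)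
      have := map_prod_eq_of_comonotone (mono T hT) (mono T' hT') hk (h (t + 1))
      have := congrArg (Multiset.map fun p : (ℕ ×ₗ ℤ) × ℕ =>
        (p.2, (-(ofLex p.1).2).toNat + p.2 * (m + 1) ^ (t + 1))) this
      simpa only [Multiset.map_map, Function.comp_def, k, ofLex_toLex, neg_neg, Int.toNat_natCast,
        ← code_succ] using this
  have hcode : T.map (fun I => code I m) = T'.map (fun I => code I m) := by
    have := congrArg (Multiset.map Prod.snd) (key m le_rfl)
    simpa only [Multiset.map_map, Function.comp_def] using this
  exact Multiset.map_injective (fun I J hIJ => eq_of_height_eq (height_eq_of_code_eq hIJ)) hcode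

/-- The path that follows `p(I)` up to time `t` and then makes the steps of `p(J)`. -/
def switchAt {m : ℕ} (t : ℕ) (I J : Finset (Fin m)) : Finset (Fin m) :=
  I.filter (fun i : Fin m => (i : ℕ) < t) ∪ J.filter (fun i : Fin m => ¬ (i : ℕ) < t)

theorem height_switchAt_of_le {m : ℕ} {t : ℕ} (I J : Finset (Fin m)) {r : ℕ} (hr : r ≤ t) :
    height (switchAt t I J) r = height I r := by
  unfold height switchAt
  congr 1
  ext i
  simp only [Finset.mem_filter, Finset.mem_union]
  constructor
  · rintro ⟨h | h, h'⟩
    · exact ⟨h.1, h'⟩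
    · exact absurd (h'.trans_le hr) h.2
  · rintro ⟨h, h'⟩
    exact ⟨Or.inl ⟨h, h'.trans_le hr⟩, h'⟩

theorem height_switchAt_of_ge {m : ℕ} {t : ℕ} {I J : Finset (Fin m)} (h : height I t = height J t)
    {r : ℕ} (hr : t ≤ r) : height (switchAt t I J) r = height J r := by
  induction r, hr using Nat.le_induction with
  | base => rw [height_switchAt_of_le I J le_rfl, h]
  | succ r hr ih =>
    by_cases hrm : r < m
    · have e1 := height_succ (switchAt t I J) ⟨r, hrm⟩
      have e2 := height_succ J ⟨r, hrm⟩
      have e3 : (⟨r, hrm⟩ : Fin m) ∈ switchAt t I J ↔ (⟨r, hrm⟩ : Fin m) ∈ J := by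
        simp [switchAt, not_lt.mpr hr, hr]
      simp only [e3] at e1 e2
      rw [e1, e2, ih]
    · rw [height_of_le _ (by omega), height_of_le _ (by omega)] at ih ⊢
      exact ih

/-- Switching the ends of two paths that meet at time `t` and violate the avoidance condition there
decreases the sum of `code I t * height I (t + 1)`. -/
theorem exists_avoidsUntil_succ {m t : ℕ} (n : ℕ) :
    ∀ T : Multiset (Finset (Fin m)), (∀ I ∈ T, ∀ J ∈ T, AvoidsUntil t I J) →
      (T.map fun I => code I t * height I (t + 1)).sum < n →
      ∃ T', SameHeights T T' ∧ ∀ I ∈ T', ∀ J ∈ T', AvoidsUntil (t + 1) I J := by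
  classical
  induction n with
  | zero => intro T _ h; omega
  | succ n ih =>
    intro T hT hn
    by_cases h : ∀ I ∈ T, ∀ J ∈ T, AvoidsUntil (t + 1) I J
    · exact ⟨T, fun _ => rfl, h⟩
    simp only [AvoidsUntil, not_forall] at h
    obtain ⟨I, hI, J, hJ, r, hr, heq, hlt, hle⟩ := h
    obtain rfl : r = t := by
      by_contra hne
      exact hle (hT I hI J hJ r (by omega) heq hlt)
    have hIJ : J ≠ I := by rintro rfl; exact hle le_rfl
    -- `I` and `J` meet at time `r`, so they can exchange their ends
    obtain ⟨T₁, rfl⟩ := Multiset.exists_cons_of_mem hI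
    obtain ⟨R, rfl⟩ := Multiset.exists_cons_of_mem ((Multiset.mem_cons.mp hJ).resolve_left hIJ)
    set I' := switchAt r I J with hI'
    set J' := switchAt r J I with hJ'
    have hsame : SameHeights (I ::ₘ J ::ₘ R) (I' ::ₘ J' ::ₘ R) := by
      intro s
      simp only [Multiset.map_cons]
      rcases le_total s r with hs | hs
      · rw [height_switchAt_of_le I J hs, height_switchAt_of_le J I hs]
      · rw [height_switchAt_of_ge heq hs, height_switchAt_of_ge heq.symm hs, Multiset.cons_swap]
    have hpast : ∀ K ∈ I' ::ₘ J' ::ₘ R, ∃ K' ∈ I ::ₘ J ::ₘ R,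
        ∀ s ≤ r, height K s = height K' s := by
      intro K hK
      simp only [Multiset.mem_cons] at hK
      rcases hK with rfl | rfl | hK
      · exact ⟨I, by simp, fun s hs => height_switchAt_of_le I J hs⟩
      · exact ⟨J, by simp, fun s hs => height_switchAt_of_le J I hs⟩
      · exact ⟨K, by simp [hK], fun s _ => rfl⟩
    have hav : ∀ K ∈ I' ::ₘ J' ::ₘ R, ∀ K' ∈ I' ::ₘ J' ::ₘ R, AvoidsUntil r K K' := by
      intro K hK K' hK' s hs h1 h2
      obtain ⟨L, hL, e⟩ := hpast K hK
      obtain ⟨L', hL', e'⟩ := hpast K' hK'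
      rw [e s hs.le, e' s hs.le] at h1
      rw [code_congr fun p hp => e p (by omega), code_congr fun p hp => e' p (by omega)] at h2
      rw [e _ hs, e' _ hs]
      exact hT L hL L' hL' s hs h1 h2
    have hdec : ((I' ::ₘ J' ::ₘ R).map fun I => code I r * height I (r + 1)).sum < n := by
      refine lt_of_lt_of_le ?_ (Nat.lt_succ_iff.mp hn)
      simp only [Multiset.map_cons, Multiset.sum_cons]
      rw [code_congr (I := I') fun p hp => height_switchAt_of_le I J hp,
        code_congr (I := J') fun p hp => height_switchAt_of_le J I hp,
        height_switchAt_of_ge heq (Nat.le_succ r), height_switchAt_of_ge heq.symm (Nat.le_succ r)]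
      obtain ⟨x, hx⟩ := Nat.exists_eq_add_of_lt hlt
      obtain ⟨y, hy⟩ := Nat.exists_eq_add_of_lt (not_le.mp hle)
      rw [hx, hy]
      nlinarith
    obtain ⟨T', h1, h2⟩ := ih _ hav hdec
    exact ⟨T', hsame.trans h1, h2⟩

theorem exists_avoidsUntil {m : ℕ} (S : Multiset (Finset (Fin m))) (t : ℕ) :
    ∃ T, SameHeights S T ∧ ∀ I ∈ T, ∀ J ∈ T, AvoidsUntil t I J := by
  induction t with
  | zero => exact ⟨S, fun _ => rfl, fun I _ J _ r hr => absurd hr (Nat.not_lt_zero r)⟩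
  | succ t ih =>
    obtain ⟨T, h1, h2⟩ := ih
    obtain ⟨T', h3, h4⟩ := exists_avoidsUntil_succ _ T h2 (Nat.lt_succ_self _)
    exact ⟨T', h1.trans h3, h4⟩

/-! ### The non-crossing rule in terms of paths -/

/-- The entries `i_1 < i_2 < …` of `I`, numbered from `0` and continued by `m`, which stands for
the symbol `∞` of the non-crossing rule. -/
def entry {m : ℕ} (I : Finset (Fin m)) (s : ℕ) : ℕ :=
  if h : s < I.card then I.orderEmbOfFin rfl ⟨s, h⟩ else m

theorem entry_of_ge {m : ℕ} {I : Finset (Fin m)} {s : ℕ} (h : I.card ≤ s) : entry I s = m :=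
  dif_neg (not_lt.mpr h)

theorem entry_eq_getElem {m : ℕ} {I : Finset (Fin m)} {s : ℕ}
    (h : s < (I.sort (· ≤ ·)).length) : entry I s = ((I.sort (· ≤ ·))[s] : ℕ) := by
  have h' : s < I.card := by simpa using h
  rw [entry, dif_pos h', Finset.orderEmbOfFin_apply]
  rfl

theorem entry_le {m : ℕ} (I : Finset (Fin m)) (s : ℕ) : entry I s ≤ m := by
  rw [entry]; split_ifs
  · exact (Fin.is_lt _).le
  · exact le_rfl

theorem entry_lt_iff {m : ℕ} (I : Finset (Fin m)) (s : ℕ) {t : ℕ} (ht : t ≤ m) :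
    entry I s < t ↔ s < height I t := by
  rw [entry]; split_ifs with h
  · exact orderEmbOfFin_lt_iff I ⟨s, h⟩ t
  · have := height_le_card I t
    omega

theorem entry_mono {m : ℕ} (I : Finset (Fin m)) : Monotone (entry I) := by
  intro s s' hs
  by_contra h
  have h1 := entry_le I s
  have h2 := (entry_lt_iff I s' (t := entry I s' + 1) (by omega)).mp (Nat.lt_succ_self _)
  have h3 := (entry_lt_iff I s (t := entry I s' + 1) (by omega)).not.mp (by omega)
  omega

/-- The sequence `g` crosses `f` from below: there are pairs of entries at the same positions, with
equal entries in between, of which the one in `g` starts first and ends inside that of `f`. -/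
def CrossesBelow (f g : ℕ → ℕ) : Prop :=
  ∃ s t, s < t ∧ (∀ r, s < r → r < t → f r = g r) ∧ g s < f s ∧ f s < g t ∧ g t < f t

/-- Two entries cross exactly where the paths touch: `p(J)` descends to `p(I)` with the east step
that faces the north step at `f s`, and leaves it upwards with the north step at `g t`. -/
theorem crossesBelow_iff {m : ℕ} (I J : Finset (Fin m)) :
    CrossesBelow (entry I) (entry J) ↔ ¬ AvoidsUntil m I J := by
  simp only [AvoidsUntil, not_forall]
  constructor
  · rintro ⟨s, t, hst, hmid, h1, h2, h3⟩
    set q := entry I s with hq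
    set r := entry J t with hr
    have hIt := entry_le I t
    have hI : ∀ n ≤ r, height I n ≤ t := fun n hn => by
      have := (entry_lt_iff I t (t := n) (by omega)).not.mp (by omega); omega
    have hJ : ∀ n ≤ r, height J n ≤ t := fun n hn => by
      have := (entry_lt_iff J t (t := n) (by omega)).not.mp (by omega); omega
    have heq : ∀ n, q < n → n ≤ r → height I n = height J n := by
      intro n hqn hnr
      have hs1 := (entry_lt_iff I s (t := n) (by omega)).mp (by omega)
      have hs2 := (entry_lt_iff J s (t := n) (by omega)).mp (by omega)
      have ht1 := hI n hnr
      have ht2 := hJ n hnr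
      refine eq_of_forall_lt_iff fun e => ?_
      rcases Nat.lt_or_ge s e with h | h
      · rcases Nat.lt_or_ge e t with h' | h'
        · rw [← entry_lt_iff I e (by omega), ← entry_lt_iff J e (by omega), hmid e h h']
        · omega
      · omega
    refine ⟨r, by omega, heq r (by omega) le_rfl, (code_lt_code_iff I J r).mpr
      ⟨q, by omega, ?_, heq⟩, ?_⟩
    · have e1 := (entry_lt_iff I s (t := q) (by omega)).not.mp (by omega)
      have e2 := (entry_lt_iff J s (t := q) (by omega)).mp (by omega)
      omega
    · have e1 := (entry_lt_iff I t (t := r + 1) (by omega)).not.mp (by omega)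
      have e2 := (entry_lt_iff J t (t := r + 1) (by omega)).mp (by omega)
      omega
  · rintro ⟨r, hrm, heq, hlt, hle⟩
    obtain ⟨q, hqr, hq, hmid⟩ := (code_lt_code_iff I J r).mp hlt
    have hqr' : q ≠ r := by rintro rfl; omega
    have i1 := height_mono I (Nat.le_succ q)
    have i2 := height_succ_le J r
    have i3 := height_succ_le I q
    have i4 := height_mono J (Nat.le_succ q)
    have i5 := height_mono I (Nat.le_succ r)
    have i6 := hmid (q + 1) (by omega) (by omega)
    have i7 := height_mono I (show q + 1 ≤ r by omega)
    simp only [Nat.succ_eq_add_one] at i1 i4 i5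
    have a1 := (entry_lt_iff I (height I q) (t := q) (by omega)).not.mpr (by omega)
    have a2 := (entry_lt_iff I (height I q) (t := q + 1) (by omega)).mpr (by omega)
    have a3 := (entry_lt_iff J (height I q) (t := q) (by omega)).mpr (by omega)
    have b1 := (entry_lt_iff J (height I r) (t := r) (by omega)).not.mpr (by omega)
    have b2 := (entry_lt_iff J (height I r) (t := r + 1) (by omega)).mpr (by omega)
    have b3 := (entry_lt_iff I (height I r) (t := r + 1) (by omega)).not.mpr (by omega)
    refine ⟨height I q, height I r, by omega, fun e h1 h2 => ?_, by omega, by omega, by omega⟩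
    have hmid' : ∀ n, q < n → n ≤ r → (entry I e < n ↔ entry J e < n) := fun n hn hnr => by
      rw [entry_lt_iff I e (by omega), entry_lt_iff J e (by omega), hmid n hn hnr]
    have c1 := (entry_lt_iff I e (t := q + 1) (by omega)).not.mpr (by omega)
    have c2 := (hmid' (q + 1) (by omega) (by omega)).not.mp c1
    have c3 := (entry_lt_iff I e (t := r) (by omega)).mpr (by omega)
    have c4 := (hmid' r (by omega) (by omega)).mp c3
    refine le_antisymm ?_ ?_
    · have := (hmid' (entry J e + 1) (by omega) (by omega)).mpr (by omega)
      omega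
    · have := (hmid' (entry I e + 1) (by omega) (by omega)).mp (by omega)
      omega

/-- Consecutive elements of a filtered list are the selected elements of the list between which no
element is selected. -/
theorem isChain_filter_iff {α : Type*} (R : α → α → Prop) (p : α → Bool) (l : List α) :
    (l.filter p).IsChain R ↔ ∀ e f (_ : e < f) (_ : f < l.length), p l[e] → p l[f] →
      (∀ r (_ : e < r) (_ : r < f), ¬ p l[r]) → R l[e] l[f] := by
  induction l with
  | nil => simp
  | cons a l ih =>
    have shift : (∀ e f (_ : e < f) (_ : f < (a :: l).length), p (a :: l)[e] → p (a :: l)[f] →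
        (∀ r (_ : e < r) (_ : r < f), ¬ p (a :: l)[r]) → R (a :: l)[e] (a :: l)[f]) ↔
        (p a → ∀ f (_ : f < l.length), p l[f] → (∀ r (_ : r < f), ¬ p l[r]) → R a l[f]) ∧
        (l.filter p).IsChain R := by
      rw [ih]
      constructor
      · intro h
        refine ⟨fun ha f hf hpf hr => ?_, fun e f hef hf he hpf hr => ?_⟩
        · refine h 0 (f + 1) (by omega) (by simpa using hf) ha (by simpa using hpf) ?_
          intro r h1 h2
          obtain ⟨r, rfl⟩ : ∃ r', r = r' + 1 := ⟨r - 1, by omega⟩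
          simpa using hr r (by omega)
        · refine h (e + 1) (f + 1) (by omega) (by simpa using hf) (by simpa using he)
            (by simpa using hpf) ?_
          intro r h1 h2
          obtain ⟨r, rfl⟩ : ∃ r', r = r' + 1 := ⟨r - 1, by omega⟩
          simpa using hr r (by omega) (by omega)
      · rintro ⟨h1, h2⟩ e f hef hf he hpf hr
        obtain ⟨f, rfl⟩ : ∃ f', f = f' + 1 := ⟨f - 1, by omega⟩
        rcases e with _ | e
        · refine h1 he f (by simpa using hf) hpf fun r hrf => ?_
          exact hr (r + 1) (by omega) (by omega)
        · refine h2 e f (by omega) (by simpa using hf) he hpf fun r h3 h4 => ?_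
          exact hr (r + 1) (by omega) (by omega)
    rw [shift]
    by_cases ha : p a
    · rw [List.filter_cons_of_pos ha, List.isChain_cons, List.head?_filter]
      simp only [ha, forall_const]
      refine and_congr_left fun _ => ⟨fun h f hf hpf hr => ?_, fun h y hy => ?_⟩
      · refine h _ ?_
        rw [Option.mem_def, List.find?_eq_some_iff_getElem]
        exact ⟨hpf, f, hf, rfl, fun j hj => by simpa using hr j hj⟩
      · rw [Option.mem_def, List.find?_eq_some_iff_getElem] at hy
        obtain ⟨hp, f, hf, rfl, hr⟩ := hy
        exact h f hf hp fun r hrf => by simpa using hr r hrf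
    · rw [List.filter_cons_of_neg ha]
      simp [ha]

/-- The pairs of entries of `I` and `J` at the positions `0, …, |I|`, where `|I| ≤ |J|`. The last
pair consists of `∞` and the first entry of `J` beyond the length of `I`. -/
def entryPairs {m : ℕ} (I J : Finset (Fin m)) : List (ℕ × ℕ) :=
  ((I.sort (· ≤ ·)).zip (J.sort (· ≤ ·))).map (fun q => ((q.1 : ℕ), (q.2 : ℕ))) ++
    [(m, entry J I.card)]

theorem length_entryPairs {m : ℕ} {I J : Finset (Fin m)} (h : I.card ≤ J.card) :
    (entryPairs I J).length = I.card + 1 := by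
  simp [entryPairs, h]

theorem getElem_entryPairs {m : ℕ} {I J : Finset (Fin m)} (h : I.card ≤ J.card) (e : ℕ)
    (he : e < (entryPairs I J).length) : (entryPairs I J)[e] = (entry I e, entry J e) := by
  have he' := he
  rw [length_entryPairs h] at he'
  simp only [entryPairs]
  rcases Nat.lt_or_ge e I.card with hlt | hge
  · rw [List.getElem_append_left (by simp; omega), entry_eq_getElem (by simpa using hlt),
      entry_eq_getElem (by simp; omega)]
    simp
  · obtain rfl : e = I.card := by omega
    rw [List.getElem_append_right (by simp)]
    simp [entry_of_ge]

theorem nonCrossingPairs_map {m : ℕ} (u v x y : Fin m) :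
    NonCrossingPairs (u : ℕ) (v : ℕ) (x : ℕ) (y : ℕ) ↔ NonCrossingPairs u v x y := by
  simp only [NonCrossingPairs, Fin.lt_def]

theorem nonCrossingLE_iff_isChain {m : ℕ} {I J : Finset (Fin m)} (h : I.card ≤ J.card) :
    NonCrossingLE I J ↔ ((entryPairs I J).filter fun q => decide (q.1 ≠ q.2)).IsChain
      fun p q => NonCrossingPairs p.1 q.1 p.2 q.2 := by
  have hfilter : ((entryPairs I J).filter fun q => decide (q.1 ≠ q.2)) =
      (differing I J).map (fun q => ((q.1 : ℕ), (q.2 : ℕ))) ++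
        if m = entry J I.card then [] else [(m, entry J I.card)] := by
    rw [entryPairs, List.filter_append, List.filter_map, differing]
    congr 1
    · congr 2
      ext q
      simp [Fin.ext_iff]
    · split_ifs with hm <;> simp [hm]
  have h1 : (∀ s (h : s + 1 < (restSmall I J).length) (h' : s + 1 < (restLarge I J).length),
      NonCrossingPairs (restSmall I J)[s] (restSmall I J)[s + 1]
        (restLarge I J)[s] (restLarge I J)[s + 1]) ↔
      ((differing I J).map (fun q => ((q.1 : ℕ), (q.2 : ℕ)))).IsChain
        fun p q => NonCrossingPairs p.1 q.1 p.2 q.2 := by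
    rw [List.isChain_map, List.isChain_iff_getElem]
    simp only [nonCrossingPairs_map]
    constructor
    · intro H s hs
      have := H s (by simpa [restSmall] using hs) (by simp [restLarge]; omega)
      simpa [restSmall, restLarge, List.getElem_append_left, hs, Nat.lt_of_succ_lt hs] using this
    · intro H s hs hs'
      have hs1 : s + 1 < (differing I J).length := by simpa [restSmall] using hs
      have := H s hs1
      simpa [restSmall, restLarge, List.getElem_append_left, hs1, Nat.lt_of_succ_lt hs1] using this
  have hlen : (restLarge I J).length = (differing I J).length + (J.card - I.card) := by
    simp [restLarge]
  rw [NonCrossingLE, h1, hfilter, List.isChain_append]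
  refine and_congr_right fun _ => ?_
  rcases h.eq_or_lt with heq | hlt
  · rw [if_pos (entry_of_ge heq.ge).symm]
    refine iff_of_true (fun s hs hs' => ?_) (by simp)
    rw [hlen] at hs'
    simp only [restSmall, List.length_map] at hs
    omega
  · have hJ : I.card < (J.sort (· ≤ ·)).length := by simpa using hlt
    have hent := entry_eq_getElem hJ
    have hm : m ≠ entry J I.card := by
      rw [hent]
      exact (Fin.is_lt _).ne'
    rw [if_neg hm]
    simp only [List.isChain_singleton, List.head?_cons, Option.mem_def, Option.some.injEq,
      forall_eq', true_and]
    rw [hent, List.getLast?_eq_getElem?]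
    rcases Nat.eq_zero_or_pos (differing I J).length with h0 | hpos
    · refine iff_of_true (fun s hs => ?_) ?_
      · simp [restSmall, h0] at hs
      · simp [List.length_eq_zero_iff.mp h0]
    · obtain ⟨n, hn⟩ : ∃ n, (differing I J).length = n + 1 := ⟨_, (Nat.succ_pred hpos.ne').symm⟩
      have hn' : n < (differing I J).length := by omega
      have key : NonCrossingPairs (((differing I J)[n].1 : Fin m) : WithTop (Fin m)) ⊤
          (((differing I J)[n].2 : Fin m) : WithTop (Fin m))
          (((J.sort (· ≤ ·))[I.card] : Fin m) : WithTop (Fin m)) ↔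
          NonCrossingPairs ((differing I J)[n].1 : ℕ) m ((differing I J)[n].2 : ℕ)
            ((J.sort (· ≤ ·))[I.card] : ℕ) := by
        simp [NonCrossingPairs]
      have hsmall : n + 1 = (restSmall I J).length := by simp [restSmall, hn]
      have hlarge : n + 1 < (restLarge I J).length := by rw [hlen]; omega
      have e1 : (restSmall I J)[n] = (differing I J)[n].1 := by simp [restSmall]
      have e2 : (restLarge I J)[n] = (differing I J)[n].2 := by
        simp [restLarge, List.getElem_append_left, hn']
      have e3 : (restLarge I J)[n + 1] = (J.sort (· ≤ ·))[I.card] := by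
        simp only [restLarge]
        rw [List.getElem_append_right (by simp [hn])]
        simp [hn]
      constructor
      · intro H x hx
        have := H n hsmall hlarge
        rw [e1, e2, e3, key] at this
        simp only [List.length_map, hn, Nat.add_sub_cancel, List.getElem?_map,
          List.getElem?_eq_getElem hn', Option.map_some, Option.some.injEq] at hx
        rw [← hx]
        exact this
      · intro H s hs hs'
        obtain rfl : s = n := by omega
        rw [e1, e2, e3, key]
        refine H ((differing I J)[s].1, (differing I J)[s].2) ?_
        simp [hn]

theorem nonCrossingLE_iff {m : ℕ} {I J : Finset (Fin m)} (h : I.card ≤ J.card) :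
    NonCrossingLE I J ↔ AvoidsUntil m I J ∧ AvoidsUntil m J I := by
  have e1 := (crossesBelow_iff I J).not_left
  have e2 := (crossesBelow_iff J I).not_left
  rw [nonCrossingLE_iff_isChain h, isChain_filter_iff, ← e1, ← e2]
  simp only [length_entryPairs h, getElem_entryPairs h, decide_eq_true_eq, not_not]
  constructor
  · intro H
    constructor
    · rintro ⟨s, t, hst, hmid, h1, h2, h3⟩
      -- beyond the length of `I` all entries of `I` are `∞`, so there is no crossing there
      have ht : t < I.card + 1 := by
        by_contra ht
        have c1 := entry_le I t
        have c2 := entry_le J t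
        rcases Nat.lt_or_ge s I.card with hs | hs
        · have c3 := hmid I.card hs (by omega)
          rw [entry_of_ge le_rfl] at c3
          have c4 := entry_mono J (show I.card ≤ t by omega)
          omega
        · rw [entry_of_ge hs] at h2
          omega
      exact (H s t hst ht (by omega) (by omega) hmid).1 ⟨h1, h2, h3⟩
    · rintro ⟨s, t, hst, hmid, h1, h2, h3⟩
      have ht : t < I.card + 1 := by
        by_contra ht
        have c2 := entry_le J t
        rw [entry_of_ge (I := I) (by omega)] at h3
        omega
      exact (H s t hst ht (by omega) (by omega) fun r a b => (hmid r a b).symm).2 ⟨h1, h2, h3⟩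
  · rintro ⟨H1, H2⟩ e f hef hf he hpf hmid
    exact ⟨fun h => H1 ⟨e, f, hef, hmid, h⟩,
      fun h => H2 ⟨e, f, hef, fun r a b => (hmid r a b).symm, h⟩⟩

/-- Two sets are non-crossing if and only if neither path descends to the other one and leaves it
again upwards. -/
theorem nonCrossing_iff {m : ℕ} (I J : Finset (Fin m)) :
    NonCrossing I J ↔ AvoidsUntil m I J ∧ AvoidsUntil m J I := by
  rw [NonCrossing]
  split_ifs with h
  · exact nonCrossingLE_iff h
  · rw [nonCrossingLE_iff (not_le.mp h).le, and_comm]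

theorem avoidsUntil_self {m : ℕ} (t : ℕ) (I : Finset (Fin m)) : AvoidsUntil t I I :=
  fun _ _ _ h => absurd h (lt_irrefl _)

theorem avoidsUntil_of_isFace {m : ℕ} {a : Finset (Fin (m + 1))}
    (T : Tableau a (NonCrossing (m := m))) :
    ∀ I ∈ T.1.map Subtype.val, ∀ J ∈ T.1.map Subtype.val, AvoidsUntil m I J := by
  intro I hI J hJ
  obtain ⟨I', hI', rfl⟩ := Multiset.mem_map.mp hI
  obtain ⟨J', hJ', rfl⟩ := Multiset.mem_map.mp hJ
  by_cases h : I' = J'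
  · rw [h]; exact avoidsUntil_self m _
  · exact ((nonCrossing_iff _ _).mp (T.2 hI' hJ' h)).1

theorem hasUniqueTableaux_nonCrossing {m : ℕ} (a : Finset (Fin (m + 1))) :
    HasUniqueTableaux a (NonCrossing (m := m)) := by
  constructor
  · intro S
    obtain ⟨T, h1, h2⟩ := exists_avoidsUntil (S.map Subtype.val) m
    obtain ⟨T, rfl⟩ := exists_map_val_eq S T h1.map_card.symm
    refine ⟨⟨T, fun I hI J hJ _ => ?_⟩, h1⟩
    have hI' := Multiset.mem_map_of_mem Subtype.val hI
    have hJ' := Multiset.mem_map_of_mem Subtype.val hJ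
    exact (nonCrossing_iff _ _).mpr ⟨h2 _ hI' _ hJ', h2 _ hJ' _ hI'⟩
  · intro T T' h
    exact Subtype.ext (Multiset.map_injective Subtype.val_injective
      (eq_of_avoidsUntil (avoidsUntil_of_isFace T) (avoidsUntil_of_isFace T') h))

end PluckerGT

theorem mainTheorem2 (m : ℕ) (a : Finset (Fin (m + 1))) :
    (∀ c : Finset (Fin m) → Finset (Fin m) → Prop, (∀ I J, c I J → c J I) →
      PluckerGT.Triangulates a c → PluckerGT.IsIntegral a c →
      PluckerGT.MonomialsFormBasis a c) ∧
    PluckerGT.MonomialsFormBasis a (PluckerGT.NonCrossing (m := m)) :=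
  ⟨fun _ _ ht hi => (PluckerGT.hasUniqueTableaux_of_triangulates ht hi).monomialsFormBasis,
    (PluckerGT.hasUniqueTableaux_nonCrossing a).monomialsFormBasis⟩
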